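/- Setting. Let $\mathbb T=\mathbb R/2\pi\mathbb Z$ with normalized Lebesgue measure $\mu$, and let $X$ be a (real or complex) Banach function lattice on $\mathbb T$, i.e. a Banach space of measurable functions on $\mathbb T$ such that 1. if $f$ is measurable, $g\in X$ and $|f|\le |g|$ almost everywhere, then $f\in X$ and $\|f\|_X\le\|g\|_X$; 2. if $f_j\in X$, $\sup_j\|f_j\|_X<\infty$ and $0\le f_j\uparrow f$, then $f\in X$ and $\|f_j\|_X\to\|f\|_X$; 3. for every measurable $E\subset\mathbb T$ we have $\chi_E\in X$, and there is $c_E>0$ with $\int_E|f|\,d\mu\le c_E\|f\|_X$ for all $f\in X$. The elements of $X$ are functions with a finite value at every point of $\mathbb T$ (not equivalence classes); functions that agree almost everywhere have the same norm. For $h>0$ put $$A_hf(x)=\frac1h\int_{x-h/2}^{x+h/2}f(t)\,dt,\qquad \dot A_hf(x)=A_hf\left(x+\tfrac h2\right).$$ Assume that $A_hf\in X$ for all $f\in X$ and $h>0$, and that $\sup\{\|A_hf\|_X: h>0,\ \|f\|_X\le1\}<\infty$. Let $\gamma,\gamma'>0$ and, for each integer $n\ge1$, let $x_k=x_{k,n}$,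 $k=1,\dots,m_n$, be points of $\mathbb T$ such that, with the convention $x_{m_n+1}=2\pi+x_1$, $$\frac{\gamma}{n}\le x_{k+1}-x_k\le\frac{\gamma'}{n},\qquad k=1,\dots,m_n .$$ Put $\|f\|_{X_n}=\bigl\|\sum_{k=1}^{m_n}|f(x_k)|\,\chi_{[x_k,x_{k+1})}\bigr\|_X$. For an integer $s\ge1$ let $X^s$ be the set of functions $g$ on $\mathbb T$ such that $g^{(s-1)}$ is absolutely continuous and $g^{(s)}\in X$, and for $f\in X$ and $h>0$ define the semi-discrete $K$-functional $$K_s(f,h)_{X_n}=\inf_{g\in X^s}\left(\|f-g\|_X+\|f-g\|_{X_n}+h^s\|g^{(s)}\|_X\right).$$ Theorem 3.4. Let $r,s\ge1$ be integers with $2r\ge s$. Then there are constants $c,C>0$, independent of $f$ and $n$, such that for all integers $n\ge1$ and all $f\in X$ $$c\left(\|(I-\dot A_{\gamma/n})^sf\|_X+\|(I-A_{\gamma/n})^rf\|_{X_n}\right)\le K_s(f,1/n)_{X_n}\le C\left(\|(I-\dot A_{\gamma/n})^sf\|_X+\|(I-A_{\gamma/n})^rf\|_{X_n}\right).$$ 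-/

import Mathlib

open Filter Topology MeasureTheory

namespace SemiDiscrete

/-- A Banach function lattice `X` on the circle `𝕋 = ℝ / 2πℤ`, with real or complex scalars.
Functions on the circle are represented by `2π`-periodic functions on `ℝ`, and "measurable" means
Lebesgue measurable. The elements of `X` are genuine functions, with a finite value at each point,
and not classes; as usual, the order in `ideal` is the almost everywhere order, so that `norm` is a
seminorm on functions and a norm on the classes of functions that agree almost everywhere. The
values of `norm` outside of `carrier` have no meaning. -/
structure BanachFunctionLattice (𝕜 : Type*) [RCLike 𝕜] where
  /-- the functions that belong to the space -/
  carrier : Submodule 𝕜 (ℝ → 𝕜)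
  /-- the norm of the space -/
  norm : (ℝ → 𝕜) → ℝ
  periodic : ∀ f ∈ carrier, Function.Periodic f (2 * Real.pi)
  measurable : ∀ f ∈ carrier, AEStronglyMeasurable f volume
  norm_add_le : ∀ f ∈ carrier, ∀ g ∈ carrier, norm (f + g) ≤ norm f + norm g
  norm_smul : ∀ (c : 𝕜), ∀ f ∈ carrier, norm (c • f) = ‖c‖ * norm f
  complete : ∀ F : ℕ → ℝ → 𝕜, (∀ n, F n ∈ carrier) →
    (∀ ε > 0, ∃ N, ∀ m ≥ N, ∀ n ≥ N, norm (F m - F n) < ε) →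
    ∃ f ∈ carrier, Tendsto (fun n => norm (F n - f)) atTop (𝓝 0)
  /-- If `|f| ≤ |g|` and `g ∈ X`, then `f ∈ X` and `‖f‖ ≤ ‖g‖`. -/
  ideal : ∀ f g : ℝ → 𝕜, Function.Periodic f (2 * Real.pi) → AEStronglyMeasurable f volume →
    g ∈ carrier → (∀ᵐ t, ‖f t‖ ≤ ‖g t‖) → f ∈ carrier ∧ norm f ≤ norm g
  /-- The Fatou property: `fₙ ∈ X`, `sup ‖fₙ‖ < ∞` and `0 ≤ fₙ ↑ f` imply that
  `f ∈ X` and `‖fₙ‖ → ‖f‖`. -/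
  fatou : ∀ (F : ℕ → ℝ → ℝ) (f : ℝ → ℝ),
    (∀ n, (fun t => (F n t : 𝕜)) ∈ carrier) →
    BddAbove (Set.range fun n => norm (fun t => (F n t : 𝕜))) →
    (∀ n t, 0 ≤ F n t) → (∀ t, Monotone fun n => F n t) →
    (∀ t, Tendsto (fun n => F n t) atTop (𝓝 (f t))) →
    (fun t => (f t : 𝕜)) ∈ carrier ∧
      Tendsto (fun n => norm (fun t => (F n t : 𝕜))) atTop (𝓝 (norm (fun t => (f t : 𝕜))))
  /-- The characteristic function of each measurable subset of the circle belongs to `X`. -/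
  indicator_mem : ∀ E : Set ℝ, NullMeasurableSet E volume →
    (∀ t, t + 2 * Real.pi ∈ E ↔ t ∈ E) → E.indicator (fun _ => (1 : 𝕜)) ∈ carrier
  /-- `∫_E |f| dμ ≤ c_E ‖f‖`, where `μ` is the normalized Lebesgue measure on the circle. -/
  integral_le : ∀ E : Set ℝ, NullMeasurableSet E volume →
    (∀ t, t + 2 * Real.pi ∈ E ↔ t ∈ E) → ∃ c : ℝ, 0 < c ∧ ∀ f ∈ carrier,
      (ENNReal.ofReal (2 * Real.pi))⁻¹ * ∫⁻ t in E ∩ Set.Ico (-Real.pi) Real.pi, ‖f t‖ₑ ≤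
        ENNReal.ofReal (c * norm f)

variable {𝕜 : Type*} [RCLike 𝕜]

/-- The Steklov average `A_h f(x) = (1/h) ∫_{x-h/2}^{x+h/2} f(t) dt`. -/
noncomputable def steklov (h : ℝ) (f : ℝ → 𝕜) (x : ℝ) : 𝕜 :=
  (h⁻¹ : ℝ) • ∫ t in (x - h / 2)..(x + h / 2), f t

/-- The one-sided Steklov average `Ȧ_h f(x) = A_h f(x + h/2)`. -/
noncomputable def dotSteklov (h : ℝ) (f : ℝ → 𝕜) (x : ℝ) : 𝕜 :=
  steklov h f (x + h / 2)

/-- `(I - A)^r f` for an operator `A` on functions. -/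
def powOneSub (A : (ℝ → 𝕜) → ℝ → 𝕜) (r : ℕ) (f : ℝ → 𝕜) : ℝ → 𝕜 :=
  (fun g => g - A g)^[r] f

/-- Steklov averages act in `X` and are uniformly bounded:
`sup {‖A_h f‖ : h > 0, ‖f‖ ≤ 1} < ∞`. -/
def BanachFunctionLattice.SteklovBounded (X : BanachFunctionLattice 𝕜) : Prop :=
  (∀ f ∈ X.carrier, ∀ h : ℝ, 0 < h → steklov h f ∈ X.carrier) ∧
    ∃ C : ℝ, ∀ h : ℝ, 0 < h → ∀ f ∈ X.carrier, X.norm f ≤ 1 → X.norm (steklov h f) ≤ C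

/-- The Sobolev-type space `X^s`, `s ≥ 1`: the functions `g` on the circle for which `g^(s-1)`
exists everywhere and is absolutely continuous, and `g^(s) ∈ X`. The derivative `g^(s)` exists
almost everywhere; `iteratedDeriv` gives it the value `0` on the exceptional null set, which does
not affect membership in `X` or the norm. -/
def BanachFunctionLattice.sobolev (X : BanachFunctionLattice 𝕜) (s : ℕ) : Set (ℝ → 𝕜) :=
  {g | Function.Periodic g (2 * Real.pi) ∧ ContDiff ℝ ((s - 1 : ℕ) : WithTop ℕ∞) g ∧
    (∀ a b : ℝ, AbsolutelyContinuousOnInterval (iteratedDeriv (s - 1) g) a b) ∧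
    iteratedDeriv s g ∈ X.carrier}

/-- Sets of nodes `x_{1,n}, …, x_{m_n,n}` on the circle, for `n ≥ 1`, with the convention
`x_{m_n+1,n} = 2π + x_{1,n}` and with `γ/n ≤ x_{k+1,n} - x_{k,n} ≤ γ'/n`. The points of the circle
are represented by real numbers. -/
structure Nodes (γ γ' : ℝ) where
  /-- the number of nodes of order `n` -/
  m : ℕ → ℕ
  /-- the node `x_{k,n}` is `x n k` -/
  x : ℕ → ℕ → ℝ
  wrap : ∀ n, 1 ≤ n → x n (m n + 1) = 2 * Real.pi + x n 1
  lower : ∀ n, 1 ≤ n → ∀ k, 1 ≤ k → k ≤ m n → γ / n ≤ x n (k + 1) - x n k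
  upper : ∀ n, 1 ≤ n → ∀ k, 1 ≤ k → k ≤ m n → x n (k + 1) - x n k ≤ γ' / n

/-- The arc `[a, b)` of the circle, as a `2π`-periodic set of real numbers. -/
def arc (a b : ℝ) : Set ℝ :=
  {t | ∃ j : ℤ, t + j * (2 * Real.pi) ∈ Set.Ico a b}

/-- The semi-norm `‖f‖_{X_n} = ‖∑_{k=1}^{m_n} |f(x_k)| χ_{[x_k, x_{k+1})}‖_X`. -/
noncomputable def BanachFunctionLattice.discreteNorm (X : BanachFunctionLattice 𝕜) {γ γ' : ℝ}
    (N : Nodes γ γ') (n : ℕ) (f : ℝ → 𝕜) : ℝ :=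
  X.norm fun t => ∑ k ∈ Finset.Icc 1 (N.m n),
    (arc (N.x n k) (N.x n (k + 1))).indicator (fun _ => ((‖f (N.x n k)‖ : ℝ) : 𝕜)) t

/-- The semi-discrete `K`-functional
`K_s(f,h)_{X_n} = inf_{g ∈ X^s} (‖f - g‖_X + ‖f - g‖_{X_n} + h^s ‖g^(s)‖_X)`. -/
noncomputable def BanachFunctionLattice.kFunctional (X : BanachFunctionLattice 𝕜) {γ γ' : ℝ}
    (N : Nodes γ γ') (n s : ℕ) (f : ℝ → 𝕜) (h : ℝ) : ℝ :=
  ⨅ g : X.sobolev s, (X.norm (f - g.1) + X.discreteNorm N n (f - g.1) +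
    h ^ s * X.norm (iteratedDeriv s g.1))

end SemiDiscrete

/-! Put `h = γ/n`, let `A` and `B` be the symmetric and the one-sided average of width `h`, and let
`p`, `q` be the continuous and the discrete seminorm. Every operator bound rests on one principle: a
function dominated pointwise by window integrals of `|f|` is dominated in `p` by `f`, because a
window integral is a Steklov average of `|f|`. Nodes are spaced at scale `1/n`, so the same
domination bounds `q`; in particular `q (A f) ≤ K p f`.

Lower estimate: split `f = (f - g) + g` with `g ∈ X^s`. Each factor `1 - B` acting on `g` gains one
factor `h` and one derivative. By symmetry each factor `1 - A` can gain two, so `2r ≥ s` suffices.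
On `f - g` the identity `u - (1 - A)^r u = ∑ A (1 - A)^i u` leaves only `q (f - g)` and multiples of
`p (f - g)`.

Upper estimate: take `g = B^(2s) φ` with `φ = ∑_{i<s} (1 - B^(2s))^i f`. Then `f - g = (1 -
B^(2s))^s f` contains the factor `(1 - B)^s`, and `h^s g^(s) = W^s φ`, where `W f = h (B² f)'` is a
difference of averages. The core is `p (W f) ≤ K p ((1 - B) f)`
(`SteklovBound.exists_diffAverageEnd_le`). It follows from an integral equation for `W f` whose
kernel has mass `1/2`. Finally, `q (f - g)` is estimated by passing through `(1 - A)^r`, which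
brings in the other term of the right-hand side.

The algebra is carried out for abstract seminorms under `AveragingEstimates`; the analysis verifies
these estimates with a constant independent of `n`. -/

namespace SemiDiscrete

variable {𝕜 : Type*} [RCLike 𝕜]

/-! ### Norm estimates in a lattice with bounded Steklov averages -/

namespace BanachFunctionLattice

variable (X : BanachFunctionLattice 𝕜)

/-- The elements of a Banach function lattice, as a type. -/
def Space : Type _ := X.carrier

instance : AddCommGroup X.Space := inferInstanceAs (AddCommGroup X.carrier)

instance : Module 𝕜 X.Space := inferInstanceAs (Module 𝕜 X.carrier)

instance : CoeOut X.Space (ℝ → 𝕜) := ⟨fun f => f.1⟩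

variable {X} in
@[ext]
lemma Space.ext {f g : X.Space} (h : ∀ x, (f : ℝ → 𝕜) x = (g : ℝ → 𝕜) x) : f = g :=
  Subtype.ext (funext h)

variable {X} in
lemma Space.exists_coe_eq {f : ℝ → 𝕜} (hf : f ∈ X.carrier) : ∃ g : X.Space, (g : ℝ → 𝕜) = f :=
  ⟨⟨f, hf⟩, rfl⟩

variable {X} in
lemma Space.coe_add (f g : X.Space) : ((f + g : X.Space) : ℝ → 𝕜) = f + g := rfl

variable {X} in
lemma Space.coe_sub (f g : X.Space) : ((f - g : X.Space) : ℝ → 𝕜) = f - g := rfl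

variable {X} in
lemma Space.coe_smul (c : 𝕜) (f : X.Space) : ((c • f : X.Space) : ℝ → 𝕜) = c • f := rfl

/-- The norm of a Banach function lattice as a seminorm on the functions in the space. -/
noncomputable def seminorm : Seminorm 𝕜 X.Space :=
  Seminorm.of (fun f => X.norm f) (fun f g => X.norm_add_le f f.2 g g.2)
    (fun c f => X.norm_smul c f f.2)

lemma seminorm_apply (f : X.Space) : X.seminorm f = X.norm f := rfl

variable {X} {f : ℝ → 𝕜}

lemma norm_nonneg (hf : f ∈ X.carrier) : 0 ≤ X.norm f :=
  apply_nonneg X.seminorm ⟨f, hf⟩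

lemma intervalIntegrable (hf : f ∈ X.carrier) (a b : ℝ) : IntervalIntegrable f volume a b := by
  refine (X.periodic f hf).intervalIntegrable (t := -Real.pi) (by positivity) ?_ a b
  rw [show -Real.pi + 2 * Real.pi = Real.pi by ring,
    intervalIntegrable_iff_integrableOn_Ico_of_le (by linarith [Real.pi_pos])]
  refine ⟨(X.measurable f hf).restrict, ?_⟩
  obtain ⟨c, -, hc⟩ := X.integral_le Set.univ nullMeasurableSet_univ (by simp)
  have h := (hc f hf).trans_lt ENNReal.ofReal_lt_top
  rw [Set.univ_inter] at h
  refine lt_top_iff_ne_top.2 fun htop => ?_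
  rw [htop, ENNReal.mul_top (ENNReal.inv_ne_zero.2 ENNReal.ofReal_ne_top)] at h
  exact lt_irrefl _ h

lemma norm_mem (hf : f ∈ X.carrier) : (fun t => ((‖f t‖ : ℝ) : 𝕜)) ∈ X.carrier ∧
    X.norm (fun t => ((‖f t‖ : ℝ) : 𝕜)) ≤ X.norm f := by
  refine X.ideal _ f (fun t => ?_) ?_ hf (by simp)
  · simp only [X.periodic f hf t]
  · exact RCLike.continuous_ofReal.comp_aestronglyMeasurable (X.measurable f hf).norm

lemma mem_of_continuous (hp : Function.Periodic f (2 * Real.pi)) (hf : Continuous f) :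
    f ∈ X.carrier := by
  obtain ⟨c, hc⟩ := (isCompact_Icc (a := (0 : ℝ)) (b := 2 * Real.pi)).exists_bound_of_continuousOn
    hf.continuousOn
  have h1 : (fun _ => (1 : 𝕜)) ∈ X.carrier := by
    simpa using X.indicator_mem Set.univ nullMeasurableSet_univ (by simp)
  refine (X.ideal f ((c : 𝕜) • fun _ => (1 : 𝕜)) hp hf.aestronglyMeasurable
    (X.carrier.smul_mem _ h1) (ae_of_all _ fun t => ?_)).1
  obtain ⟨y, hy, hty⟩ := hp.exists_mem_Ico₀ Real.two_pi_pos t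
  rw [hty]
  simpa using (hc y ⟨hy.1, hy.2.le⟩).trans (le_abs_self c)

lemma SteklovBounded.exists_bound (hX : X.SteklovBounded) :
    ∃ C : ℝ, 1 ≤ C ∧ ∀ h : ℝ, 0 < h → ∀ f ∈ X.carrier,
      X.norm (steklov h f) ≤ C * X.norm f := by
  obtain ⟨hmem, C, hC⟩ := hX
  refine ⟨max C 1, le_max_right _ _, fun h hh f hf => ?_⟩
  -- The norm of `f` may vanish, so `f` is normalized by `‖f‖ + ε` and `ε` tends to zero afterwards.
  have key : ∀ ε > 0, X.norm (steklov h f) ≤ max C 1 * (X.norm f + ε) := by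
    intro ε hε
    have hpos : 0 < X.norm f + ε := by linarith [norm_nonneg hf]
    set d : 𝕜 := (((X.norm f + ε)⁻¹ : ℝ) : 𝕜) with hd
    have hdn : ‖d‖ = (X.norm f + ε)⁻¹ := by
      rw [hd, RCLike.norm_ofReal, abs_of_pos (by positivity)]
    have hs : steklov h (d • f) = d • steklov h f := by
      ext x
      simp only [steklov, Pi.smul_apply, intervalIntegral.integral_smul]
      rw [smul_comm]
    have h1 := hC h hh (d • f) (X.carrier.smul_mem _ hf) (by
      rw [X.norm_smul _ _ hf, hdn, inv_mul_le_iff₀ hpos]; linarith)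
    rw [hs, X.norm_smul _ _ (hmem f hf h hh), hdn, inv_mul_le_iff₀ hpos, mul_comm] at h1
    exact h1.trans (by gcongr; exact le_max_left _ _)
  refine le_of_forall_pos_le_add fun ε hε => ?_
  have h0 : 0 < max C 1 := lt_max_of_lt_right one_pos
  have := key (ε / max C 1) (by positivity)
  rwa [mul_add, mul_div_cancel₀ _ h0.ne'] at this

/-- `C` bounds the norms of the Steklov averages in `X`. -/
def SteklovBound (X : BanachFunctionLattice 𝕜) (C : ℝ) : Prop :=
  0 ≤ C ∧ ∀ h : ℝ, 0 < h → ∀ f ∈ X.carrier,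
    steklov h f ∈ X.carrier ∧ X.norm (steklov h f) ≤ C * X.norm f

lemma SteklovBound.integral_norm_mem {C : ℝ} (hC : X.SteklovBound C) (hf : f ∈ X.carrier)
    {R : ℝ} (hR : 0 < R) :
    (fun x => ((∫ t in (x - R)..(x + R), ‖f t‖ : ℝ) : 𝕜)) ∈ X.carrier ∧
      X.norm (fun x => ((∫ t in (x - R)..(x + R), ‖f t‖ : ℝ) : 𝕜)) ≤ 2 * R * C * X.norm f := by
  obtain ⟨hn, hn'⟩ := norm_mem hf
  obtain ⟨hG, hG'⟩ := hC.2 (2 * R) (by positivity) _ hn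
  have heq : (fun x => ((∫ t in (x - R)..(x + R), ‖f t‖ : ℝ) : 𝕜)) =
      ((2 * R : ℝ) : 𝕜) • steklov (2 * R) fun t => ((‖f t‖ : ℝ) : 𝕜) := by
    ext x
    rw [Pi.smul_apply, steklov, mul_div_cancel_left₀ R two_ne_zero, RCLike.intervalIntegral_ofReal,
      smul_eq_mul, ← RCLike.real_smul_eq_coe_mul, smul_inv_smul₀ (by positivity)]
  rw [heq, X.norm_smul _ _ hG, RCLike.norm_ofReal, abs_of_pos (by positivity), mul_assoc _ C]
  exact ⟨X.carrier.smul_mem _ hG, mul_le_mul_of_nonneg_left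
    (hG'.trans (mul_le_mul_of_nonneg_left hn' hC.1)) (by positivity)⟩

lemma integral_norm_nonneg (f : ℝ → 𝕜) (x : ℝ) {R : ℝ} (hR : 0 < R) :
    0 ≤ ∫ t in (x - R)..(x + R), ‖f t‖ :=
  intervalIntegral.integral_nonneg (by linarith) fun _ _ => _root_.norm_nonneg _

/-- The window integral is `2R` times the Steklov average of `|f|` of width `2R`, so the ideal
property transfers its bound to `F`. Uncentred windows are covered by enlarging `R`; no translation
invariance of `X` is needed. -/
lemma SteklovBound.of_norm_le_integral {C : ℝ} (hC : X.SteklovBound C) (hf : f ∈ X.carrier)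
    {F : ℝ → 𝕜} (hp : Function.Periodic F (2 * Real.pi)) (hm : AEStronglyMeasurable F volume)
    {κ R : ℝ} (hκ : 0 ≤ κ) (hR : 0 < R)
    (hF : ∀ x, ‖F x‖ ≤ κ * ∫ t in (x - R)..(x + R), ‖f t‖) :
    F ∈ X.carrier ∧ X.norm F ≤ 2 * κ * R * C * X.norm f := by
  obtain ⟨hn, hn'⟩ := hC.integral_norm_mem hf hR
  obtain ⟨h1, h2⟩ := X.ideal F _ hp hm (X.carrier.smul_mem (κ : 𝕜) hn) (ae_of_all _ fun x => by
    rw [Pi.smul_apply, _root_.norm_smul, RCLike.norm_ofReal, RCLike.norm_ofReal, abs_of_nonneg hκ,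
      abs_of_nonneg (integral_norm_nonneg f x hR)]
    exact hF x)
  refine ⟨h1, h2.trans ?_⟩
  rw [X.norm_smul _ _ hn, RCLike.norm_ofReal, abs_of_nonneg hκ]
  calc κ * _ ≤ κ * (2 * R * C * X.norm f) := mul_le_mul_of_nonneg_left hn' hκ
    _ = _ := by ring

/-- Serves an absorption argument: once `2 * κ' * R * C` is below one, the last term can be moved to
the left. -/
lemma SteklovBound.norm_le_of_le_add {C : ℝ} (hC : X.SteklovBound C) {e w : X.Space}
    {κ κ' R : ℝ} (hκ : 0 ≤ κ) (hκ' : 0 ≤ κ') (hR : 0 < R)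
    (hw : ∀ x, ‖(w : ℝ → 𝕜) x‖ ≤ ‖(e : ℝ → 𝕜) x‖ +
      κ * (∫ t in (x - R)..(x + R), ‖(e : ℝ → 𝕜) t‖) +
      κ' * ∫ t in (x - R)..(x + R), ‖(w : ℝ → 𝕜) t‖) :
    X.seminorm w ≤ (1 + 2 * κ * R * C) * X.seminorm e + 2 * κ' * R * C * X.seminorm w := by
  obtain ⟨h1, h1'⟩ := norm_mem e.2
  obtain ⟨h2, h2'⟩ := hC.integral_norm_mem e.2 hR
  obtain ⟨h3, h3'⟩ := hC.integral_norm_mem w.2 hR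
  obtain ⟨E₁, hE₁⟩ := Space.exists_coe_eq h1
  obtain ⟨E₂, hE₂⟩ := Space.exists_coe_eq h2
  obtain ⟨E₃, hE₃⟩ := Space.exists_coe_eq h3
  have hle : X.seminorm w ≤ X.seminorm (E₁ + (κ : 𝕜) • E₂ + (κ' : 𝕜) • E₃) := by
    refine (X.ideal w _ (X.periodic w w.2) (X.measurable w w.2)
      (E₁ + (κ : 𝕜) • E₂ + (κ' : 𝕜) • E₃).2 (ae_of_all _ fun x => (hw x).trans ?_)).2
    have : ((E₁ + (κ : 𝕜) • E₂ + (κ' : 𝕜) • E₃ : X.Space) : ℝ → 𝕜) x =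
        ((‖(e : ℝ → 𝕜) x‖ + κ * (∫ t in (x - R)..(x + R), ‖(e : ℝ → 𝕜) t‖) +
          κ' * ∫ t in (x - R)..(x + R), ‖(w : ℝ → 𝕜) t‖ : ℝ) : 𝕜) := by
      simp [hE₁, hE₂, hE₃, Space.coe_add, Space.coe_smul, RCLike.real_smul_eq_coe_mul]
    rw [this, RCLike.norm_ofReal]
    exact le_abs_self _
  refine hle.trans ((map_add_le_add _ _ _).trans
    ((add_le_add (map_add_le_add _ _ _) le_rfl).trans ?_))
  rw [map_smul_eq_mul, map_smul_eq_mul, RCLike.norm_ofReal, RCLike.norm_ofReal, abs_of_nonneg hκ,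
    abs_of_nonneg hκ']
  have i2 := mul_le_mul_of_nonneg_left h2' hκ
  have i3 := mul_le_mul_of_nonneg_left h3' hκ'
  simp only [seminorm_apply, hE₁, hE₂, hE₃]
  linarith

end BanachFunctionLattice

/-! ### Averaging operators over shifted windows -/

/-- The average of `f` over `[x + a, x + a + h]`. -/
noncomputable def average (a h : ℝ) (f : ℝ → 𝕜) (x : ℝ) : 𝕜 :=
  (h⁻¹ : ℝ) • ∫ t in (x + a)..(x + a + h), f t

lemma steklov_eq_average (h : ℝ) : (steklov h : (ℝ → 𝕜) → ℝ → 𝕜) = average (-(h / 2)) h := by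
  ext f x
  rw [steklov, average, show x + -(h / 2) + h = x + h / 2 by ring, sub_eq_add_neg]

lemma dotSteklov_eq_average (h : ℝ) :
    (dotSteklov h : (ℝ → 𝕜) → ℝ → 𝕜) = average 0 h := by
  ext f x
  rw [dotSteklov, steklov, average, add_zero, add_sub_cancel_right, add_assoc, add_halves]

namespace BanachFunctionLattice

variable {X : BanachFunctionLattice 𝕜} {f : ℝ → 𝕜}

lemma continuous_average (hf : f ∈ X.carrier) (a h : ℝ) : Continuous (average a h f) := by
  have hi := intervalIntegrable hf
  have : average a h f = fun x => (h⁻¹ : ℝ) •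
      ((∫ t in (0 : ℝ)..(x + a + h), f t) - ∫ t in (0 : ℝ)..(x + a), f t) := by
    ext x
    rw [average, intervalIntegral.integral_interval_sub_left (hi _ _) (hi _ _)]
  rw [this]
  have hc := intervalIntegral.continuous_primitive hi 0
  fun_prop

lemma periodic_average (hf : Function.Periodic f (2 * Real.pi)) (a h : ℝ) :
    Function.Periodic (average a h f) (2 * Real.pi) := fun x => by
  simp only [average]
  rw [show x + 2 * Real.pi + a = (x + a) + 2 * Real.pi by ring,
    show x + a + 2 * Real.pi + h = (x + a + h) + 2 * Real.pi by ring,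
    ← intervalIntegral.integral_comp_add_right]
  simp only [hf _]

lemma average_mem (hf : f ∈ X.carrier) (a h : ℝ) : average a h f ∈ X.carrier :=
  mem_of_continuous (periodic_average (X.periodic f hf) a h) (continuous_average hf a h)

variable (X) in
/-- The averages over `[x + a, x + a + h]` as an operator in `X`. -/
noncomputable def averageEnd (a h : ℝ) : Module.End 𝕜 X.Space where
  toFun f := ⟨average a h f, average_mem f.2 a h⟩
  map_add' f g := by
    ext x
    simp only [average, Space.coe_add, Pi.add_apply]
    rw [intervalIntegral.integral_add (intervalIntegrable f.2 _ _) (intervalIntegrable g.2 _ _),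
      smul_add]
    rfl
  map_smul' c f := by
    ext x
    simp only [average, Space.coe_smul, Pi.smul_apply, intervalIntegral.integral_smul,
      RingHom.id_apply]
    rw [smul_comm]
    rfl

lemma averageEnd_apply (a h : ℝ) (f : X.Space) (x : ℝ) :
    (X.averageEnd a h f : ℝ → 𝕜) x = (h⁻¹ : ℝ) • ∫ t in (x + a)..(x + a + h), (f : ℝ → 𝕜) t := rfl

lemma powOneSub_average (a h : ℝ) (r : ℕ) (f : X.Space) :
    powOneSub (average a h) r (f : ℝ → 𝕜) = (((1 - X.averageEnd a h) ^ r) f : X.Space) := by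
  induction r generalizing f with
  | zero => rfl
  | succ r ih =>
    have := ih ((1 - X.averageEnd a h) f)
    rw [pow_succ, Module.End.mul_apply, ← this]
    rfl

lemma integral_norm_mono (hf : f ∈ X.carrier) {a b c d : ℝ} (hca : c ≤ a) (hab : a ≤ b)
    (hbd : b ≤ d) : ∫ t in a..b, ‖f t‖ ≤ ∫ t in c..d, ‖f t‖ :=
  intervalIntegral.integral_mono_interval hca hab hbd
    (ae_of_all _ fun _ => _root_.norm_nonneg _) (intervalIntegrable hf _ _).norm

lemma norm_average_le (hf : f ∈ X.carrier) {a h R : ℝ} (hh : 0 < h) (ha : -R ≤ a)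
    (hb : a + h ≤ R) (x : ℝ) :
    ‖average a h f x‖ ≤ h⁻¹ * ∫ t in (x - R)..(x + R), ‖f t‖ := by
  rw [average, _root_.norm_smul, Real.norm_of_nonneg (by positivity)]
  gcongr
  refine (intervalIntegral.norm_integral_le_integral_norm (by linarith)).trans ?_
  exact integral_norm_mono hf (by linarith) (by linarith) (by linarith)

end BanachFunctionLattice

/-! ### Weak derivatives and the error of averaging -/

namespace BanachFunctionLattice

variable {X : BanachFunctionLattice 𝕜} {h : ℝ} {g w v : X.Space}

/-- `w` is `h` times the (weak) derivative of `g`. -/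
def IsDeriv (h : ℝ) (g w : X.Space) : Prop :=
  ∀ a b : ℝ, ∫ t in a..b, (w : ℝ → 𝕜) t = h • ((g : ℝ → 𝕜) b - (g : ℝ → 𝕜) a)

lemma IsDeriv.sub {g' w' : X.Space} (h₁ : IsDeriv h g w) (h₂ : IsDeriv h g' w') :
    IsDeriv h (g - g') (w - w') := fun a b => by
  simp only [Space.coe_sub, Pi.sub_apply]
  rw [intervalIntegral.integral_sub (intervalIntegrable w.2 _ _) (intervalIntegrable w'.2 _ _),
    h₁, h₂, ← smul_sub]
  congr 1
  abel

lemma IsDeriv.averageEnd (h₁ : IsDeriv h g w) (a k : ℝ) :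
    IsDeriv h (X.averageEnd a k g) (X.averageEnd a k w) := fun y z => by
  have hi := intervalIntegrable g.2
  simp only [averageEnd_apply, intervalIntegral.integral_smul, h₁ _ _]
  have hi' : ∀ c, IntervalIntegrable (fun t => (g : ℝ → 𝕜) (t + c)) volume y z := fun c => by
    simpa using (hi (y + c) (z + c)).comp_add_right c
  simp only [add_assoc]
  rw [intervalIntegral.integral_sub (hi' _) (hi' _),
    intervalIntegral.integral_comp_add_right (fun t => (g : ℝ → 𝕜) t) a]
  rw [intervalIntegral.integral_comp_add_right (fun t => (g : ℝ → 𝕜) t) (a + k),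
    intervalIntegral.integral_interval_sub_interval_comm' (hi _ _) (hi _ _) (hi _ _),
    ← smul_sub, smul_comm]

lemma IsDeriv.one_sub_averageEnd (h₁ : IsDeriv h g w) (a k : ℝ) :
    IsDeriv h ((1 - X.averageEnd a k) g) ((1 - X.averageEnd a k) w) :=
  h₁.sub (h₁.averageEnd a k)

lemma IsDeriv.continuous (hh : h ≠ 0) (h₁ : IsDeriv h g w) : Continuous (g : ℝ → 𝕜) := by
  have : (g : ℝ → 𝕜) = fun x => (g : ℝ → 𝕜) 0 + h⁻¹ • ∫ t in (0 : ℝ)..x, (w : ℝ → 𝕜) t := by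
    ext x
    rw [h₁, inv_smul_smul₀ hh, add_sub_cancel]
  rw [this]
  have hc := intervalIntegral.continuous_primitive (intervalIntegrable w.2) 0
  fun_prop

lemma IsDeriv.hasDerivAt (hh : h ≠ 0) (h₁ : IsDeriv h g w) (hw : Continuous (w : ℝ → 𝕜))
    (x : ℝ) : HasDerivAt (g : ℝ → 𝕜) (h⁻¹ • (w : ℝ → 𝕜) x) x := by
  have : (g : ℝ → 𝕜) = fun x => (g : ℝ → 𝕜) 0 + h⁻¹ • ∫ t in (0 : ℝ)..x, (w : ℝ → 𝕜) t := by
    ext x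
    rw [h₁, inv_smul_smul₀ hh, add_sub_cancel]
  rw [this]
  have hd : HasDerivAt (fun x => ∫ t in (0 : ℝ)..x, (w : ℝ → 𝕜) t) ((w : ℝ → 𝕜) x) x :=
    intervalIntegral.integral_hasDerivAt_right (hw.intervalIntegrable _ _)
      (hw.stronglyMeasurableAtFilter _ _) hw.continuousAt
  exact (hd.const_smul h⁻¹).const_add _

lemma IsDeriv.norm_sub_le (hh : 0 < h) (h₁ : IsDeriv h g w) {x y z R : ℝ}
    (hy : |y - x| ≤ R) (hz : |z - x| ≤ R) :
    ‖(g : ℝ → 𝕜) z - (g : ℝ → 𝕜) y‖ ≤ h⁻¹ * ∫ t in (x - R)..(x + R), ‖(w : ℝ → 𝕜) t‖ := by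
  wlog hyz : y ≤ z generalizing y z
  · rw [norm_sub_rev]
    exact this hz hy (le_of_not_ge hyz)
  rw [abs_le] at hy hz
  rw [show (g : ℝ → 𝕜) z - (g : ℝ → 𝕜) y = h⁻¹ • ∫ t in y..z, (w : ℝ → 𝕜) t by
    rw [h₁, inv_smul_smul₀ hh.ne'], _root_.norm_smul, Real.norm_of_nonneg (by positivity)]
  gcongr
  refine (intervalIntegral.norm_integral_le_integral_norm hyz).trans ?_
  exact integral_norm_mono w.2 (by linarith) hyz (by linarith)

lemma norm_average_le_of_norm_le {φ : ℝ → 𝕜} {a k x M : ℝ} (hk : 0 < k)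
    (hM : ∀ t ∈ Set.Icc (x + a) (x + a + k), ‖φ t‖ ≤ M) : ‖average a k φ x‖ ≤ M := by
  have := intervalIntegral.norm_integral_le_of_norm_le_const (a := x + a) (b := x + a + k)
    (f := φ) (C := M) fun t ht => hM t (by
      rw [Set.uIoc_of_le (by linarith)] at ht
      exact ⟨ht.1.le, ht.2⟩)
  rw [average, _root_.norm_smul, Real.norm_of_nonneg (by positivity), inv_mul_le_iff₀ hk]
  rwa [add_sub_cancel_left, abs_of_pos hk, mul_comm] at this

/-- The error at `x` is the average of `g x - g t` over a window within distance `h` of `x`, and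
each difference is an integral of the derivative. -/
lemma IsDeriv.norm_one_sub_averageEnd_le (hh : 0 < h) (h₁ : IsDeriv h g w) {a : ℝ}
    (ha : -h ≤ a) (ha' : a ≤ 0) (x : ℝ) : ‖((1 - X.averageEnd a h) g : ℝ → 𝕜) x‖ ≤
      h⁻¹ * ∫ t in (x - h)..(x + h), ‖(w : ℝ → 𝕜) t‖ := by
  have : ((1 - X.averageEnd a h) g : ℝ → 𝕜) x =
      average a h (fun t => (g : ℝ → 𝕜) x - (g : ℝ → 𝕜) t) x := by
    rw [average, intervalIntegral.integral_sub (by simp) (intervalIntegrable g.2 _ _), smul_sub,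
      intervalIntegral.integral_const, add_sub_cancel_left, inv_smul_smul₀ hh.ne']
    rfl
  rw [this]
  refine norm_average_le_of_norm_le hh fun t ht => h₁.norm_sub_le hh ?_ (by simp [hh.le])
  rw [abs_le]
  constructor <;> linarith [ht.1, ht.2]

/-- The linear Taylor term at `x` has mean zero over a window centred at `x`. The error is thus the
average of the first-order Taylor remainder, which the second derivative controls. -/
lemma IsDeriv.norm_one_sub_averageEnd_le' (hh : 0 < h) (h₁ : IsDeriv h g w)
    (h₂ : IsDeriv h w v) (x : ℝ) : ‖((1 - X.averageEnd (-(h / 2)) h) g : ℝ → 𝕜) x‖ ≤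
      h⁻¹ * ∫ t in (x - h)..(x + h), ‖(v : ℝ → 𝕜) t‖ := by
  set M := h⁻¹ * ∫ t in (x - h)..(x + h), ‖(v : ℝ → 𝕜) t‖
  have hlin : ∀ k : ℝ, ∫ t in (x + -(h / 2))..(x + -(h / 2) + h), (t - x) = k * 0 := fun k => by
    rw [intervalIntegral.integral_comp_sub_right (fun t => t), integral_id]
    ring
  have : ((1 - X.averageEnd (-(h / 2)) h) g : ℝ → 𝕜) x = average (-(h / 2)) h
      (fun t => (g : ℝ → 𝕜) x - (g : ℝ → 𝕜) t + (t - x) • (h⁻¹ • (w : ℝ → 𝕜) x)) x := by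
    rw [average, intervalIntegral.integral_add ((by simp : IntervalIntegrable
      (fun _ => (g : ℝ → 𝕜) x) volume _ _).sub (intervalIntegrable g.2 _ _))
      (Continuous.intervalIntegrable (by fun_prop) _ _),
      intervalIntegral.integral_sub (by simp) (intervalIntegrable g.2 _ _),
      intervalIntegral.integral_smul_const, hlin 0, mul_zero, zero_smul, add_zero, smul_sub,
      intervalIntegral.integral_const, add_sub_cancel_left, inv_smul_smul₀ hh.ne']
    rfl
  rw [this]
  refine norm_average_le_of_norm_le hh fun t ht => ?_
  have htx : |t - x| ≤ h / 2 := by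
    rw [abs_le]
    constructor <;> linarith [ht.1, ht.2]
  have heq : (g : ℝ → 𝕜) x - (g : ℝ → 𝕜) t + (t - x) • (h⁻¹ • (w : ℝ → 𝕜) x) =
      h⁻¹ • ∫ y in x..t, ((w : ℝ → 𝕜) x - (w : ℝ → 𝕜) y) := by
    rw [intervalIntegral.integral_sub (by simp) (intervalIntegrable w.2 _ _), h₁,
      intervalIntegral.integral_const, smul_sub, inv_smul_smul₀ hh.ne', smul_comm]
    abel
  have hb : ‖∫ y in x..t, ((w : ℝ → 𝕜) x - (w : ℝ → 𝕜) y)‖ ≤ M * |t - x| := by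
    refine intervalIntegral.norm_integral_le_of_norm_le_const fun y hy => ?_
    refine h₂.norm_sub_le hh ?_ (by simp [hh.le])
    have := Set.abs_sub_left_of_mem_uIcc (Set.uIoc_subset_uIcc hy)
    linarith
  have hM : 0 ≤ M := mul_nonneg (by positivity)
    (intervalIntegral.integral_nonneg (by linarith) fun _ _ => _root_.norm_nonneg _)
  rw [heq, _root_.norm_smul, Real.norm_of_nonneg (by positivity), inv_mul_le_iff₀ hh, mul_comm]
  refine hb.trans (mul_le_mul_of_nonneg_left (by linarith) hM)

end BanachFunctionLattice

/-! ### The derivative of `B² f` is controlled by `(1 - B) f` -/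

/-- The kernel `y / h²` on `[0, h]` has mass `1/2`, so each substitution of the equation into itself
halves the coefficient of the `w` term and lengthens the window by `h`. The coefficient `2` of the
`e` term is stable under this: a new `1` plus half of `2`. -/
lemma norm_le_of_eq_add_integral {h : ℝ} (hh : 0 < h) {e w : ℝ → 𝕜} (he : Continuous e)
    (hw : Continuous w)
    (hwe : ∀ x, w x = e x + h⁻¹ • h⁻¹ • ∫ y in (0 : ℝ)..h, y • w (x + y)) (j : ℕ) (x : ℝ) :
    ‖w x‖ ≤ ‖e x‖ + 2 * h⁻¹ * (∫ t in x..(x + (j + 1) * h), ‖e t‖) +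
      (1 / 2) ^ j * h⁻¹ * ∫ t in x..(x + (j + 1) * h), ‖w t‖ := by
  have hmono : ∀ {φ : ℝ → 𝕜}, Continuous φ → ∀ {a b c d : ℝ}, c ≤ a → a ≤ b → b ≤ d →
      ∫ t in a..b, ‖φ t‖ ≤ ∫ t in c..d, ‖φ t‖ := fun hφ _ _ _ _ h1 h2 h3 =>
    intervalIntegral.integral_mono_interval h1 h2 h3 (ae_of_all _ fun _ => norm_nonneg _)
      (hφ.norm.intervalIntegrable _ _)
  have hnonneg : ∀ (φ : ℝ → 𝕜) {a b : ℝ}, a ≤ b → 0 ≤ ∫ t in a..b, ‖φ t‖ := fun φ _ _ hab =>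
    intervalIntegral.integral_nonneg hab fun _ _ => norm_nonneg _
  have hfirst : ∀ x, ‖w x‖ ≤ ‖e x‖ + h⁻¹ * (h⁻¹ * ∫ y in (0 : ℝ)..h, y * ‖w (x + y)‖) := by
    intro x
    conv_lhs => rw [hwe x]
    refine (norm_add_le _ _).trans ?_
    rw [norm_smul, norm_smul, Real.norm_of_nonneg (by positivity : 0 ≤ h⁻¹)]
    gcongr
    refine (intervalIntegral.norm_integral_le_integral_norm hh.le).trans_eq ?_
    refine intervalIntegral.integral_congr fun y hy => ?_
    rw [Set.uIcc_of_le hh.le] at hy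
    simp only [norm_smul, Real.norm_of_nonneg hy.1]
  induction j generalizing x with
  | zero =>
    have h1 : ∫ y in (0 : ℝ)..h, y * ‖w (x + y)‖ ≤ h * ∫ t in x..(x + h), ‖w t‖ := by
      have h2 : ∫ y in (0 : ℝ)..h, y * ‖w (x + y)‖ ≤ ∫ y in (0 : ℝ)..h, h * ‖w (x + y)‖ :=
        intervalIntegral.integral_mono_on hh.le
          (Continuous.intervalIntegrable (by fun_prop) _ _)
          (Continuous.intervalIntegrable (by fun_prop) _ _) fun y hy =>
          mul_le_mul_of_nonneg_right hy.2 (norm_nonneg _)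
      rwa [intervalIntegral.integral_const_mul,
        intervalIntegral.integral_comp_add_left (fun t => ‖w t‖), add_zero] at h2
    have h2 := hnonneg e (show x ≤ x + h by linarith)
    have h3 : h⁻¹ * (h⁻¹ * ∫ y in (0 : ℝ)..h, y * ‖w (x + y)‖) ≤
        h⁻¹ * (h⁻¹ * (h * ∫ t in x..(x + h), ‖w t‖)) := by gcongr
    rw [inv_mul_cancel_left₀ hh.ne'] at h3
    have h4 : 0 ≤ 2 * h⁻¹ * ∫ t in x..(x + h), ‖e t‖ := by positivity
    simp only [Nat.cast_zero, zero_add, one_mul, pow_zero]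
    linarith [hfirst x]
  | succ j ih =>
    rw [show x + (((j + 1 : ℕ) : ℝ) + 1) * h = x + (j + 1) * h + h by push_cast; ring]
    set L := x + (j + 1) * h + h with hL
    have hj : 0 ≤ (j + 1) * h := by positivity
    set M := 2 * h⁻¹ * (∫ t in x..L, ‖e t‖) + (1 / 2) ^ j * h⁻¹ * ∫ t in x..L, ‖w t‖ with hM
    have hb : ∀ y ∈ Set.Icc 0 h, ‖w (x + y)‖ ≤ ‖e (x + y)‖ + M := fun y hy => by
      refine (ih (x + y)).trans ?_
      have h1 : ∫ t in (x + y)..(x + y + (j + 1) * h), ‖e t‖ ≤ ∫ t in x..L, ‖e t‖ :=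
        hmono he (by linarith [hy.1]) (by linarith) (by linarith [hy.2])
      have h2 : ∫ t in (x + y)..(x + y + (j + 1) * h), ‖w t‖ ≤ ∫ t in x..L, ‖w t‖ :=
        hmono hw (by linarith [hy.1]) (by linarith) (by linarith [hy.2])
      rw [hM, add_assoc]
      gcongr
    have h1 : ∫ y in (0 : ℝ)..h, y * ‖w (x + y)‖ ≤
        h * (∫ t in x..(x + h), ‖e t‖) + h ^ 2 / 2 * M := by
      have h2 : ∫ y in (0 : ℝ)..h, y * ‖w (x + y)‖ ≤
          ∫ y in (0 : ℝ)..h, (h * ‖e (x + y)‖ + y * M) := by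
        refine intervalIntegral.integral_mono_on hh.le
          (Continuous.intervalIntegrable (by fun_prop) _ _)
          (Continuous.intervalIntegrable (by fun_prop) _ _) fun y hy => ?_
        calc y * ‖w (x + y)‖ ≤ y * (‖e (x + y)‖ + M) := mul_le_mul_of_nonneg_left (hb y hy) hy.1
          _ ≤ _ := by
            rw [mul_add]
            gcongr
            exact hy.2
      refine h2.trans_eq ?_
      rw [intervalIntegral.integral_add (Continuous.intervalIntegrable (by fun_prop) _ _)
        (Continuous.intervalIntegrable (by fun_prop) _ _), intervalIntegral.integral_const_mul,
        intervalIntegral.integral_mul_const, integral_id,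
        intervalIntegral.integral_comp_add_left (fun t => ‖e t‖), add_zero]
      ring
    have h2 : ∫ t in x..(x + h), ‖e t‖ ≤ ∫ t in x..L, ‖e t‖ :=
      hmono he le_rfl (by linarith) (by linarith)
    have h3 : h⁻¹ * (h⁻¹ * ∫ y in (0 : ℝ)..h, y * ‖w (x + y)‖) ≤
        h⁻¹ * (h⁻¹ * (h * (∫ t in x..L, ‖e t‖) + h ^ 2 / 2 * M)) := by
      gcongr
      exact h1.trans (by gcongr)
    refine (hfirst x).trans ((add_le_add_right h3 _).trans_eq ?_)
    rw [hM, pow_succ]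
    field_simp
    ring

namespace BanachFunctionLattice

variable {X : BanachFunctionLattice 𝕜} {h C : ℝ} {g w v : X.Space}

lemma SteklovBound.averageEnd_le (hC : X.SteklovBound C) (hh : 0 < h) {a : ℝ} (ha : -(2 * h) ≤ a)
    (ha' : a ≤ h) (f : X.Space) :
    X.seminorm (X.averageEnd a h f) ≤ 4 * C * X.seminorm f := by
  have := (hC.of_norm_le_integral f.2 (F := average a h f)
    (periodic_average (X.periodic f f.2) a h) (continuous_average f.2 a h).aestronglyMeasurable
    (κ := h⁻¹) (R := 2 * h) (by positivity) (by positivity)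
    (norm_average_le f.2 hh ha (by linarith))).2
  refine this.trans_eq ?_
  rw [seminorm_apply]
  field_simp
  ring

variable (X) in
/-- The first difference with step `h` of the averages over `[x, x + h]`. -/
noncomputable def diffAverageEnd (h : ℝ) : Module.End 𝕜 X.Space :=
  X.averageEnd h h - X.averageEnd 0 h

lemma diffAverageEnd_apply (f : X.Space) (x : ℝ) :
    (X.diffAverageEnd h f : ℝ → 𝕜) x = (X.averageEnd 0 h f : ℝ → 𝕜) (x + h) -
      (X.averageEnd 0 h f : ℝ → 𝕜) x := by
  simp [diffAverageEnd, averageEnd_apply, Space.coe_sub]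

lemma SteklovBound.diffAverageEnd_le (hC : X.SteklovBound C) (hh : 0 < h) (f : X.Space) :
    X.seminorm (X.diffAverageEnd h f) ≤ 8 * C * X.seminorm f := by
  refine (map_sub_le_add X.seminorm _ _).trans ?_
  have h1 := hC.averageEnd_le hh (a := h) (by linarith) le_rfl f
  have h2 := hC.averageEnd_le hh (a := 0) (by linarith) hh.le f
  linarith

lemma commute_diffAverageEnd : Commute (X.averageEnd 0 h) (X.diffAverageEnd h) := by
  suffices hc : X.averageEnd 0 h * X.averageEnd h h = X.averageEnd h h * X.averageEnd 0 h by
    rw [Commute, SemiconjBy, diffAverageEnd, mul_sub, sub_mul, hc]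
  refine LinearMap.ext fun f => Space.ext fun x => ?_
  have : ∀ t, (X.averageEnd h h f : ℝ → 𝕜) t = (X.averageEnd 0 h f : ℝ → 𝕜) (t + h) := fun t => by
    simp [averageEnd_apply]
  rw [Module.End.mul_apply, Module.End.mul_apply, averageEnd_apply, averageEnd_apply]
  simp only [this]
  rw [intervalIntegral.integral_comp_add_right (fun t => (X.averageEnd 0 h f : ℝ → 𝕜) t)]
  simp

lemma continuous_averageEnd (a : ℝ) (f : X.Space) :
    Continuous (X.averageEnd a h f : ℝ → 𝕜) :=
  continuous_average f.2 a h

lemma continuous_diffAverageEnd (f : X.Space) :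
    Continuous (X.diffAverageEnd h f : ℝ → 𝕜) :=
  (continuous_averageEnd h f).sub (continuous_averageEnd 0 f)

lemma isDeriv_diffAverageEnd (hh : 0 < h) (f : X.Space) :
    IsDeriv h ((X.averageEnd 0 h * X.averageEnd 0 h) f) (X.diffAverageEnd h f) := fun a b => by
  have hc := continuous_averageEnd (h := h) 0 f
  have hi := fun a b => hc.intervalIntegrable (μ := volume) a b
  simp only [diffAverageEnd_apply]
  rw [intervalIntegral.integral_sub
    (Continuous.intervalIntegrable (by fun_prop) _ _) (hi _ _),
    intervalIntegral.integral_comp_add_right (fun t => (X.averageEnd 0 h f : ℝ → 𝕜) t),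
    intervalIntegral.integral_interval_sub_interval_comm' (hi _ _) (hi _ _) (hi _ _),
    Module.End.mul_apply, averageEnd_apply, averageEnd_apply, ← smul_sub, smul_inv_smul₀ hh.ne']
  simp

/-- Integration by parts of `y • g' (x + y)` over `[0, h]` gives `h (g (x + h) - B g x)`. The values
`g (x + h)` and `g x` combine with `B w x = g (x + h) - g x`. -/
lemma IsDeriv.eq_add_integral (hh : 0 < h) (h₁ : IsDeriv h g w) (hw : Continuous (w : ℝ → 𝕜))
    (x : ℝ) : (w : ℝ → 𝕜) x = ((1 - X.averageEnd 0 h) (w - g) : ℝ → 𝕜) x +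
      h⁻¹ • h⁻¹ • ∫ y in (0 : ℝ)..h, y • (w : ℝ → 𝕜) (x + y) := by
  have hg := h₁.continuous hh.ne'
  have hderiv : ∀ y ∈ Set.uIcc 0 h, HasDerivAt (fun y : ℝ => y • (g : ℝ → 𝕜) (x + y))
      (y • (h⁻¹ • (w : ℝ → 𝕜) (x + y)) + (1 : ℝ) • (g : ℝ → 𝕜) (x + y)) y := fun y _ =>
    (hasDerivAt_id y).smul ((h₁.hasDerivAt hh.ne' hw (x + y)).comp_const_add x y)
  have hint := intervalIntegral.integral_eq_sub_of_hasDerivAt hderiv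
    (Continuous.intervalIntegrable (by fun_prop) _ _)
  rw [intervalIntegral.integral_add (Continuous.intervalIntegrable (by fun_prop) _ _)
    (Continuous.intervalIntegrable (by fun_prop) _ _)] at hint
  simp only [one_smul, zero_smul, sub_zero, smul_comm _ h⁻¹, intervalIntegral.integral_smul]
    at hint
  rw [intervalIntegral.integral_comp_add_left (fun t => (g : ℝ → 𝕜) t), add_zero] at hint
  have hB : ∀ f : X.Space, ((1 - X.averageEnd 0 h) f : ℝ → 𝕜) x =
      (f : ℝ → 𝕜) x - h⁻¹ • ∫ t in x..(x + h), (f : ℝ → 𝕜) t := fun f => by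
    have : ((1 - X.averageEnd 0 h) f : ℝ → 𝕜) x =
      (f : ℝ → 𝕜) x - (X.averageEnd 0 h f : ℝ → 𝕜) x := rfl
    rw [this, averageEnd_apply, add_zero]
  rw [eq_sub_of_add_eq hint, map_sub, Space.coe_sub, Pi.sub_apply, hB, hB, h₁]
  simp only [smul_sub, inv_smul_smul₀ hh.ne']
  abel

/-- With `w = W f` and `u = (1 - B) f`, the free term of the integral equation is `(1 - B)(w - B² f)
= W u - B² u` by commutation, hence controlled by `u`. Although the kernel has mass `1/2`, the
Steklov bound `C` need not make one application a contraction in `X`. Iterating pointwise first and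
taking norms once costs only a factor `2 (j + 1) C` against `2^(-j)`. -/
lemma SteklovBound.exists_diffAverageEnd_le (hC : X.SteklovBound C) :
    ∃ K : ℝ, 0 ≤ K ∧ ∀ h : ℝ, 0 < h → ∀ f : X.Space,
      X.seminorm (X.diffAverageEnd h f) ≤ K * X.seminorm ((1 - X.averageEnd 0 h) f) := by
  have hC0 := hC.1
  obtain ⟨j, hj⟩ : ∃ j : ℕ, (1 / 2 : ℝ) ^ j * (2 * (j + 1) * C) ≤ 1 / 2 := by
    have h1 := tendsto_self_mul_const_pow_of_lt_one (r := (1 / 2 : ℝ)) (by norm_num) (by norm_num)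
    have h2 := tendsto_pow_atTop_nhds_zero_of_lt_one (r := (1 / 2 : ℝ)) (by norm_num) (by norm_num)
    have h3 := (h1.add h2).mul_const (2 * C)
    rw [add_zero, zero_mul] at h3
    obtain ⟨j, hj⟩ := (h3.eventually (gt_mem_nhds (by norm_num : (0 : ℝ) < 1 / 2))).exists
    exact ⟨j, by linarith⟩
  -- The `2` comes from absorbing half of the norm of `w`, the next factor from the window integrals
  -- of `e`, and the last from `e = W u - B² u`.
  refine ⟨2 * (1 + 4 * (j + 1) * C) * (8 * C + 4 * C * (4 * C)), by positivity,
    fun h hh f => ?_⟩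
  set B := X.averageEnd 0 h with hB
  set w := X.diffAverageEnd h f with hw
  set u := (1 - B) f with hu
  have hd : IsDeriv h ((B * B) f) w := isDeriv_diffAverageEnd hh f
  have hwc : Continuous (w : ℝ → 𝕜) := continuous_diffAverageEnd f
  set e := (1 - B) (w - (B * B) f) with he
  have heu : e = X.diffAverageEnd h u - B (B u) := by
    have h1 : (1 - B) * X.diffAverageEnd h = X.diffAverageEnd h * (1 - B) := by
      rw [sub_mul, mul_sub, commute_diffAverageEnd.eq, one_mul, mul_one]
    have h2 : (1 - B) * (B * B) = B * B * (1 - B) := by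
      rw [sub_mul, mul_sub, one_mul, mul_one, mul_assoc]
    rw [he, map_sub, hw, hu, ← Module.End.mul_apply, ← Module.End.mul_apply, h1, h2]
    rfl
  have hBB : ∀ f, X.seminorm (B f) ≤ 4 * C * X.seminorm f :=
    hC.averageEnd_le hh (by linarith) hh.le
  have hpe : X.seminorm e ≤ (8 * C + 4 * C * (4 * C)) * X.seminorm u := by
    rw [heu]
    have h1 := map_sub_le_add X.seminorm (X.diffAverageEnd h u) (B (B u))
    have h2 := hC.diffAverageEnd_le hh u
    have h3 := (hBB (B u)).trans (mul_le_mul_of_nonneg_left (hBB u) (by positivity))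
    linarith
  have hec : Continuous (e : ℝ → 𝕜) :=
    (hwc.sub (hd.continuous hh.ne')).sub (continuous_averageEnd 0 _)
  have hpt := norm_le_of_eq_add_integral hh hec hwc (hd.eq_add_integral hh hwc) j
  have hR : 0 < (j + 1) * h := by positivity
  have hpw := hC.norm_le_of_le_add (e := e) (w := w) (κ := 2 * h⁻¹) (κ' := (1 / 2) ^ j * h⁻¹)
    (R := (j + 1) * h) (by positivity) (by positivity) hR fun x => by
      refine (hpt x).trans ?_
      have i1 : ∫ t in x..(x + (j + 1) * h), ‖(e : ℝ → 𝕜) t‖ ≤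
          ∫ t in (x - (j + 1) * h)..(x + (j + 1) * h), ‖(e : ℝ → 𝕜) t‖ :=
        integral_norm_mono e.2 (by linarith) (by linarith) le_rfl
      have i2 : ∫ t in x..(x + (j + 1) * h), ‖(w : ℝ → 𝕜) t‖ ≤
          ∫ t in (x - (j + 1) * h)..(x + (j + 1) * h), ‖(w : ℝ → 𝕜) t‖ :=
        integral_norm_mono w.2 (by linarith) (by linarith) le_rfl
      gcongr
  have e1 : 2 * (2 * h⁻¹) * ((j + 1) * h) * C = 4 * (j + 1) * C := by
    field_simp
    ring
  have e2 : 2 * ((1 / 2) ^ j * h⁻¹) * ((j + 1) * h) * C = (1 / 2) ^ j * (2 * (j + 1) * C) := by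
    field_simp
  rw [e1, e2] at hpw
  have h1 := mul_le_mul_of_nonneg_right hj (apply_nonneg X.seminorm w)
  have h2 := mul_le_mul_of_nonneg_left hpe (by positivity : 0 ≤ 1 + 4 * (j + 1) * C)
  linarith

end BanachFunctionLattice

/-! ### Nodes, arcs and the discrete seminorm -/

lemma add_two_pi_mem_arc (a b t : ℝ) : t + 2 * Real.pi ∈ arc a b ↔ t ∈ arc a b := by
  constructor
  · rintro ⟨j, hj⟩
    refine ⟨j + 1, ?_⟩
    convert! hj using 1
    push_cast
    ring
  · rintro ⟨j, hj⟩
    refine ⟨j - 1, ?_⟩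
    convert! hj using 1
    push_cast
    ring

lemma measurableSet_arc (a b : ℝ) : MeasurableSet (arc a b) := by
  have : arc a b = ⋃ j : ℤ, (fun t : ℝ => t + j * (2 * Real.pi)) ⁻¹' Set.Ico a b := by
    ext t
    simp only [arc, Set.mem_ofPred_eq, Set.mem_iUnion, Set.mem_preimage]
  rw [this]
  exact MeasurableSet.iUnion fun j => measurableSet_Ico.preimage (by fun_prop)

namespace Nodes

variable {γ γ' : ℝ} (N : Nodes γ γ') {n : ℕ}

lemma x_le_x (hγ : 0 < γ) (hn : 1 ≤ n) {k l : ℕ} (hk : 1 ≤ k) (hkl : k ≤ l)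
    (hl : l ≤ N.m n + 1) : N.x n k ≤ N.x n l := by
  induction l, hkl using Nat.le_induction with
  | base => rfl
  | succ l hkl ih =>
    have h1 := N.lower n hn l (hk.trans hkl) (by lia)
    have h2 : 0 < γ / n := div_pos hγ (by exact_mod_cast hn)
    linarith [ih (by lia)]

/-- For `k < l`, the ordering of the nodes forces the period shift of the second arc to exceed that
of the first by at least one, while all nodes lie within one period of `x_1`. -/
lemma eq_of_mem_arc (hγ : 0 < γ) (hn : 1 ≤ n) {k l : ℕ} (hk : k ∈ Finset.Icc 1 (N.m n))
    (hl : l ∈ Finset.Icc 1 (N.m n)) {t : ℝ} (htk : t ∈ arc (N.x n k) (N.x n (k + 1)))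
    (htl : t ∈ arc (N.x n l) (N.x n (l + 1))) : k = l := by
  by_contra hne
  wlog hkl : k < l generalizing k l
  · exact this hl hk htl htk (Ne.symm hne) (by lia)
  rw [Finset.mem_Icc] at hk hl
  obtain ⟨i, hi⟩ := htk
  obtain ⟨j, hj⟩ := htl
  have h1 := N.x_le_x hγ hn (k := k + 1) (l := l) (by lia) (by lia) (by lia)
  have h2 := N.x_le_x hγ hn (k := l + 1) (l := N.m n + 1) (by lia) (by lia) (by lia)
  have h3 := N.x_le_x hγ hn (k := 1) (l := k) (by lia) (by lia) (by lia)
  have h4 := N.wrap n hn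
  have hπ := Real.two_pi_pos
  have hij : (i : ℝ) < j := by
    refine lt_of_mul_lt_mul_right ?_ hπ.le
    linarith [hi.2, hj.1]
  have hij' : (i : ℝ) + 1 ≤ j := by exact_mod_cast hij
  have := mul_le_mul_of_nonneg_right hij' hπ.le
  linarith [hi.1, hj.2]

/-- The step function with the value `|f(x_k)|` on the arc `[x_k, x_{k+1})`. -/
noncomputable def step (n : ℕ) (f : ℝ → 𝕜) (t : ℝ) : 𝕜 :=
  ∑ k ∈ Finset.Icc 1 (N.m n),
    (arc (N.x n k) (N.x n (k + 1))).indicator (fun _ => ((‖f (N.x n k)‖ : ℝ) : 𝕜)) t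

lemma step_eq_ofReal (n : ℕ) (f : ℝ → 𝕜) (t : ℝ) : N.step n f t =
    ((∑ k ∈ Finset.Icc 1 (N.m n),
      (arc (N.x n k) (N.x n (k + 1))).indicator (fun _ => ‖f (N.x n k)‖) t : ℝ) : 𝕜) := by
  rw [RCLike.ofReal_sum]
  refine Finset.sum_congr rfl fun k _ => ?_
  by_cases h : t ∈ arc (N.x n k) (N.x n (k + 1)) <;> simp [h]

lemma norm_step (n : ℕ) (f : ℝ → 𝕜) (t : ℝ) : ‖N.step n f t‖ =
    ∑ k ∈ Finset.Icc 1 (N.m n),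
      (arc (N.x n k) (N.x n (k + 1))).indicator (fun _ => ‖f (N.x n k)‖) t := by
  rw [step_eq_ofReal, RCLike.norm_ofReal, abs_of_nonneg]
  exact Finset.sum_nonneg fun k _ => Set.indicator_nonneg (fun _ _ => norm_nonneg _) _

lemma norm_step_le (hγ : 0 < γ) (hn : 1 ≤ n) {f : ℝ → 𝕜} {t M : ℝ} (hM : 0 ≤ M)
    (h : ∀ k ∈ Finset.Icc 1 (N.m n), t ∈ arc (N.x n k) (N.x n (k + 1)) → ‖f (N.x n k)‖ ≤ M) :
    ‖N.step n f t‖ ≤ M := by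
  rw [norm_step]
  by_cases hex : ∃ k ∈ Finset.Icc 1 (N.m n), t ∈ arc (N.x n k) (N.x n (k + 1))
  · obtain ⟨k, hk, htk⟩ := hex
    rw [Finset.sum_eq_single_of_mem k hk, Set.indicator_of_mem htk]
    · exact h k hk htk
    · intro l hl hlk
      refine Set.indicator_of_notMem (fun htl => hlk ?_) _
      exact N.eq_of_mem_arc hγ hn hl hk htl htk
  · push Not at hex
    rw [Finset.sum_eq_zero fun k hk => Set.indicator_of_notMem (hex k hk) _]
    exact hM

end Nodes

namespace BanachFunctionLattice

variable {X : BanachFunctionLattice 𝕜} {γ γ' : ℝ} (N : Nodes γ γ')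

lemma step_mem (n : ℕ) (f : ℝ → 𝕜) : N.step n f ∈ X.carrier := by
  have : N.step n f = ∑ k ∈ Finset.Icc 1 (N.m n), ((‖f (N.x n k)‖ : ℝ) : 𝕜) •
      (arc (N.x n k) (N.x n (k + 1))).indicator fun _ => (1 : 𝕜) := by
    ext t
    rw [Nodes.step, Finset.sum_apply]
    refine Finset.sum_congr rfl fun k _ => ?_
    by_cases h : t ∈ arc (N.x n k) (N.x n (k + 1)) <;> simp [h]
  rw [this]
  exact X.carrier.sum_mem fun k _ => X.carrier.smul_mem _
    (X.indicator_mem _ (measurableSet_arc _ _).nullMeasurableSet (add_two_pi_mem_arc _ _))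

lemma discreteNorm_add_le (n : ℕ) (f g : ℝ → 𝕜) :
    X.discreteNorm N n (f + g) ≤ X.discreteNorm N n f + X.discreteNorm N n g := by
  have hf := step_mem (X := X) N n f
  have hg := step_mem (X := X) N n g
  have hfg := step_mem (X := X) N n (f + g)
  refine (X.ideal (N.step n (f + g)) (N.step n f + N.step n g) (X.periodic _ hfg)
    (X.measurable _ hfg) (X.carrier.add_mem hf hg) (ae_of_all _ fun t => ?_)).2.trans
      (X.norm_add_le _ hf _ hg)
  rw [Pi.add_apply, N.step_eq_ofReal n f, N.step_eq_ofReal n g, ← RCLike.ofReal_add,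
    RCLike.norm_ofReal, N.norm_step, ← Finset.sum_add_distrib]
  refine (Finset.sum_le_sum fun k _ => ?_).trans (le_abs_self _)
  by_cases h : t ∈ arc (N.x n k) (N.x n (k + 1))
  · simpa [h] using _root_.norm_add_le (f (N.x n k)) (g (N.x n k))
  · simp [h]

lemma discreteNorm_smul (n : ℕ) (c : 𝕜) (f : ℝ → 𝕜) :
    X.discreteNorm N n (c • f) = ‖c‖ * X.discreteNorm N n f := by
  have : N.step n (c • f) = ((‖c‖ : ℝ) : 𝕜) • N.step n f := by
    ext t
    rw [Pi.smul_apply, N.step_eq_ofReal, N.step_eq_ofReal, smul_eq_mul, ← RCLike.ofReal_mul,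
      Finset.mul_sum]
    congr 1
    refine Finset.sum_congr rfl fun k _ => ?_
    by_cases h : t ∈ arc (N.x n k) (N.x n (k + 1)) <;> simp [h]
  change X.norm (N.step n (c • f)) = ‖c‖ * X.norm (N.step n f)
  rw [this, X.norm_smul _ _ (step_mem N n f), RCLike.norm_ofReal, abs_norm]

variable (X) in
/-- The discrete semi-norm as a seminorm on `X`. -/
noncomputable def discreteSeminorm (n : ℕ) : Seminorm 𝕜 X.Space :=
  Seminorm.of (fun f => X.discreteNorm N n f)
    (fun f g => by rw [Space.coe_add]; exact discreteNorm_add_le N n _ _)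
    (fun c f => by rw [Space.coe_smul]; exact discreteNorm_smul N n c _)

lemma discreteSeminorm_apply (n : ℕ) (f : X.Space) :
    X.discreteSeminorm N n f = X.discreteNorm N n f := rfl

/-- On its arc the step function takes the value at a node at distance at most `γ'/n`. The window
about the node therefore lies in the window about `t` with radius enlarged by `γ'/n`, up to a period
shift. -/
lemma SteklovBound.discreteSeminorm_le {C : ℝ} (hC : X.SteklovBound C) (hγ : 0 < γ) (hγ' : 0 < γ')
    {n : ℕ} (hn : 1 ≤ n) {f F : X.Space} {κ R : ℝ} (hκ : 0 ≤ κ) (hR : 0 < R)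
    (hF : ∀ x, ‖(F : ℝ → 𝕜) x‖ ≤ κ * ∫ t in (x - R)..(x + R), ‖(f : ℝ → 𝕜) t‖) :
    X.discreteSeminorm N n F ≤ 2 * κ * (R + γ' / n) * C * X.seminorm f := by
  have hn0 : (0 : ℝ) < n := by exact_mod_cast hn
  have hδ : 0 < γ' / n := div_pos hγ' hn0
  have hs := step_mem (X := X) N n F
  refine (hC.of_norm_le_integral f.2 (X.periodic _ hs) (X.measurable _ hs) hκ
    (by positivity : 0 < R + γ' / n) fun t => ?_).2
  refine N.norm_step_le hγ hn (mul_nonneg hκ (integral_norm_nonneg _ _ (by positivity)))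
    fun k hk ⟨j, hj⟩ => (hF _).trans (mul_le_mul_of_nonneg_left ?_ hκ)
  rw [Finset.mem_Icc] at hk
  have hu := N.upper n hn k hk.1 hk.2
  have hper : Function.Periodic (fun t => ‖(f : ℝ → 𝕜) t‖) (2 * Real.pi) := fun t => by
    simp only [X.periodic f f.2 t]
  have hshift : ∫ s in (t - (R + γ' / n))..(t + (R + γ' / n)), ‖(f : ℝ → 𝕜) s‖ =
      ∫ s in (t + j * (2 * Real.pi) - (R + γ' / n))..(t + j * (2 * Real.pi) + (R + γ' / n)),
        ‖(f : ℝ → 𝕜) s‖ := by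
    rw [show t + j * (2 * Real.pi) - (R + γ' / n) = t - (R + γ' / n) + j * (2 * Real.pi) by ring,
      show t + j * (2 * Real.pi) + (R + γ' / n) = t + (R + γ' / n) + j * (2 * Real.pi) by ring,
      ← intervalIntegral.integral_comp_add_right]
    exact intervalIntegral.integral_congr fun s _ => ((hper.int_mul j) s).symm
  rw [hshift]
  exact integral_norm_mono f.2 (by linarith [hj.1, hj.2]) (by linarith) (by linarith [hj.1])

end BanachFunctionLattice

end SemiDiscrete

/-! ### The argument for abstract seminorms and operators -/

namespace SemiDiscrete

variable {𝕜 : Type*} [RCLike 𝕜] {E : Type*} [AddCommGroup E] [Module 𝕜 E] {p q : Seminorm 𝕜 E}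

lemma seminorm_pow_le {T : Module.End 𝕜 E} {K : ℝ} (hK : 0 ≤ K) (hT : ∀ f, p (T f) ≤ K * p f)
    (j : ℕ) (f : E) : p ((T ^ j) f) ≤ K ^ j * p f := by
  induction j with
  | zero => simp
  | succ j ih =>
    rw [pow_succ', Module.End.mul_apply, pow_succ', mul_assoc]
    exact (hT _).trans (mul_le_mul_of_nonneg_left ih hK)

lemma seminorm_geom_sum_le {T : Module.End 𝕜 E} {K : ℝ} (hK : 0 ≤ K)
    (hT : ∀ f, p (T f) ≤ K * p f) (j : ℕ) (f : E) :
    p ((∑ i ∈ Finset.range j, T ^ i) f) ≤ (∑ i ∈ Finset.range j, K ^ i) * p f := by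
  induction j with
  | zero => simp
  | succ j ih =>
    rw [Finset.sum_range_succ, Finset.sum_range_succ, LinearMap.add_apply, add_mul]
    exact (map_add_le_add p _ _).trans (add_le_add ih (seminorm_pow_le hK hT j f))

/-- `d` is related to `g` by an `s`-fold iteration of the relation `D`. -/
def IterRel (D : E → E → Prop) : ℕ → E → E → Prop
  | 0, g, d => g = d
  | s + 1, g, d => ∃ g', D g g' ∧ IterRel D s g' d

section

variable {D : E → E → Prop} {T : Module.End 𝕜 E} {K : ℝ}

lemma rel_pow (hD : ∀ g w, D g w → D (T g) (T w)) (j : ℕ) {g w : E} (h : D g w) :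
    D ((T ^ j) g) ((T ^ j) w) := by
  induction j with
  | zero => exact h
  | succ j ih =>
    rw [pow_succ', Module.End.mul_apply, Module.End.mul_apply]
    exact hD _ _ ih

lemma IterRel.seminorm_pow_le (hK : 0 ≤ K) (hD : ∀ g w, D g w → D (T g) (T w))
    (h₁ : ∀ g w, D g w → p (T g) ≤ K * p w) {s : ℕ} {g d : E} (h : IterRel D s g d) :
    p ((T ^ s) g) ≤ K ^ s * p d := by
  induction s generalizing g with
  | zero => obtain rfl := h; simp
  | succ s ih =>
    obtain ⟨g', hg', h⟩ := h
    rw [pow_succ', Module.End.mul_apply, pow_succ', mul_assoc]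
    exact (h₁ _ _ (rel_pow hD s hg')).trans (mul_le_mul_of_nonneg_left (ih h) hK)

/-- The outermost operator is estimated in the seminorm `q`, the others in `p`. -/
lemma IterRel.seminorm_apply_pow_le (hK : 0 ≤ K) (hD : ∀ g w, D g w → D (T g) (T w))
    (h₁ : ∀ g w, D g w → q (T g) ≤ K * p w)
    (h₂ : ∀ g w v, D g w → D w v → q (T g) ≤ K * p v) {r : ℕ}
    (hr : ∀ {s : ℕ} {g d : E}, s ≤ 2 * r → IterRel D s g d → p ((T ^ r) g) ≤ K ^ r * p d)
    {s : ℕ} {g d : E} (hs : s ≠ 0) (hsr : s ≤ 2 * (r + 1)) (h : IterRel D s g d) :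
    q ((T ^ (r + 1)) g) ≤ K ^ (r + 1) * p d := by
  rw [pow_succ', Module.End.mul_apply, pow_succ', mul_assoc]
  match s, h with
  -- The outermost factor must consume a derivative: no bound of `q (T g)` by `p g` is available.
  | 0, _ => exact absurd rfl hs
  | 1, ⟨g', hg', h⟩ =>
    exact (h₁ _ _ (rel_pow hD r hg')).trans
      (mul_le_mul_of_nonneg_left (hr (Nat.zero_le _) h) hK)
  | s + 2, ⟨g', hg', g'', hg'', h⟩ =>
    exact (h₂ _ _ _ (rel_pow hD r hg') (rel_pow hD r hg'')).trans
      (mul_le_mul_of_nonneg_left (hr (by lia) h) hK)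

/-- Each factor `T` consumes two derivatives while they last, then one or none, so `r` factors
consume all `s ≤ 2 * r`. -/
lemma IterRel.seminorm_pow_le_of_le_two_mul (hK : 0 ≤ K) (hD : ∀ g w, D g w → D (T g) (T w))
    (h₀ : ∀ g, p (T g) ≤ K * p g) (h₁ : ∀ g w, D g w → p (T g) ≤ K * p w)
    (h₂ : ∀ g w v, D g w → D w v → p (T g) ≤ K * p v) {r s : ℕ} {g d : E} (hsr : s ≤ 2 * r)
    (h : IterRel D s g d) : p ((T ^ r) g) ≤ K ^ r * p d := by
  induction r generalizing s g d with
  | zero =>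
    obtain rfl : s = 0 := by lia
    obtain rfl := h
    simp
  | succ r ih =>
    rcases eq_or_ne s 0 with rfl | hs
    · obtain rfl := h
      exact SemiDiscrete.seminorm_pow_le hK h₀ _ _
    · exact h.seminorm_apply_pow_le hK hD h₁ h₂ ih hs hsr

/-- Telescoping: `u - T^r u` is the sum of `(1 - T) T^i u`, and `1 - T` maps `p` boundedly into `q`.
-/
lemma seminorm_sub_pow_le (hK : 0 ≤ K) (h₀ : ∀ g, p (T g) ≤ K * p g)
    (hq : ∀ g, q (g - T g) ≤ K * p g) (r : ℕ) (u : E) :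
    q (u - (T ^ r) u) ≤ (∑ i ∈ Finset.range r, K * K ^ i) * p u := by
  induction r with
  | zero => simp
  | succ r ih =>
    have h : u - (T ^ (r + 1)) u = (u - (T ^ r) u) + ((T ^ r) u - T ((T ^ r) u)) := by
      rw [pow_succ', Module.End.mul_apply]
      abel
    rw [h, Finset.sum_range_succ, add_mul, mul_assoc K]
    refine (map_add_le_add q _ _).trans (add_le_add ih ((hq _).trans ?_))
    exact mul_le_mul_of_nonneg_left (seminorm_pow_le hK h₀ r u) hK

end

/-- The estimates for two averaging operators `A`, `B` and an operator `W` with `W f` a derivative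
of `B² f`, where `D g w` says that `w` is a derivative of `g`. -/
structure AveragingEstimates (p q : Seminorm 𝕜 E) (A B W : Module.End 𝕜 E) (D : E → E → Prop)
    (K : ℝ) : Prop where
  nonneg : 0 ≤ K
  commute : B * W = W * B
  rel_sq : ∀ f, D ((B * B) f) (W f)
  rel_one_sub_fst : ∀ g w, D g w → D ((1 - A) g) ((1 - A) w)
  rel_one_sub_snd : ∀ g w, D g w → D ((1 - B) g) ((1 - B) w)
  snd_le : ∀ f, p (B f) ≤ K * p f
  one_sub_fst_le : ∀ f, p ((1 - A) f) ≤ K * p f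
  one_sub_snd_le : ∀ f, p ((1 - B) f) ≤ K * p f
  fst_le' : ∀ f, q (A f) ≤ K * p f
  derivative_le : ∀ f, p (W f) ≤ K * p ((1 - B) f)
  one_sub_snd_le_of_rel : ∀ g w, D g w → p ((1 - B) g) ≤ K * p w
  one_sub_fst_le_of_rel : ∀ g w, D g w → p ((1 - A) g) ≤ K * p w
  one_sub_fst_le_of_rel_of_rel : ∀ g w v, D g w → D w v → p ((1 - A) g) ≤ K * p v
  one_sub_fst_le_of_rel' : ∀ g w, D g w → q ((1 - A) g) ≤ K * p w
  one_sub_fst_le_of_rel_of_rel' : ∀ g w v, D g w → D w v → q ((1 - A) g) ≤ K * p v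

namespace AveragingEstimates

variable {A B W : Module.End 𝕜 E} {D : E → E → Prop} {K : ℝ}

lemma sub_pow_le (hE : AveragingEstimates p q A B W D K) (r : ℕ) (u : E) :
    q (u - ((1 - A) ^ r) u) ≤ (∑ i ∈ Finset.range r, K * K ^ i) * p u := by
  refine seminorm_sub_pow_le hE.nonneg hE.one_sub_fst_le (fun g => ?_) r u
  have : g - (1 - A) g = A g := sub_sub_cancel _ _
  rw [this]
  exact hE.fst_le' g

lemma one_sub_fst_pow_le (hE : AveragingEstimates p q A B W D K) {r s : ℕ} (hr : r ≠ 0)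
    (hs : s ≠ 0) (hsr : s ≤ 2 * r) {g d : E} (h : IterRel D s g d) :
    q (((1 - A) ^ r) g) ≤ K ^ r * p d := by
  obtain ⟨r, rfl⟩ := Nat.exists_eq_succ_of_ne_zero hr
  exact h.seminorm_apply_pow_le hE.nonneg hE.rel_one_sub_fst hE.one_sub_fst_le_of_rel'
    hE.one_sub_fst_le_of_rel_of_rel' (fun hsr h => h.seminorm_pow_le_of_le_two_mul hE.nonneg
      hE.rel_one_sub_fst hE.one_sub_fst_le hE.one_sub_fst_le_of_rel
      hE.one_sub_fst_le_of_rel_of_rel hsr) hs hsr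

/-- On `f - g` the operators are bounded, up to a `q (f - g)` term; on `g` they trade its
derivatives for powers of `K`. -/
lemma add_le (hE : AveragingEstimates p q A B W D K) {r s : ℕ} (hr : r ≠ 0)
    (hs : s ≠ 0) (hsr : s ≤ 2 * r) {f g d : E} (h : IterRel D s g d) :
    p (((1 - B) ^ s) f) + q (((1 - A) ^ r) f) ≤
      (1 + K ^ s + K ^ r + ∑ i ∈ Finset.range r, K * K ^ i) * (p (f - g) + q (f - g) + p d) := by
  have hK := hE.nonneg
  have hS : 0 ≤ ∑ i ∈ Finset.range r, K * K ^ i := Finset.sum_nonneg fun i _ => by positivity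
  have h1 : p (((1 - B) ^ s) f) ≤ K ^ s * p (f - g) + K ^ s * p d := by
    rw [← sub_add_cancel f g, map_add, add_sub_cancel_right]
    exact (map_add_le_add p _ _).trans (add_le_add (seminorm_pow_le hK hE.one_sub_snd_le _ _)
      (h.seminorm_pow_le hK hE.rel_one_sub_snd hE.one_sub_snd_le_of_rel))
  have h2 : q (((1 - A) ^ r) (f - g)) ≤
      q (f - g) + (∑ i ∈ Finset.range r, K * K ^ i) * p (f - g) := by
    have h3 := map_sub_le_add q (f - g) ((f - g) - ((1 - A) ^ r) (f - g))
    rw [sub_sub_cancel] at h3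
    linarith [hE.sub_pow_le r (f - g)]
  have h3 : q (((1 - A) ^ r) f) ≤ q (((1 - A) ^ r) (f - g)) + K ^ r * p d := by
    have h4 := map_add_le_add q (((1 - A) ^ r) (f - g)) (((1 - A) ^ r) g)
    rw [← map_add, sub_add_cancel] at h4
    linarith [hE.one_sub_fst_pow_le hr hs hsr h]
  have i1 := apply_nonneg p (f - g)
  have i2 := apply_nonneg q (f - g)
  have i3 := apply_nonneg p d
  have i4 : 0 ≤ K ^ s := by positivity
  have i5 : 0 ≤ K ^ r := by positivity
  generalize ∑ i ∈ Finset.range r, K * K ^ i = S at *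
  have j1 := mul_nonneg i4 i2
  have j2 := mul_nonneg i5 i1
  have j3 := mul_nonneg i5 i2
  have j4 := mul_nonneg hS i2
  have j5 := mul_nonneg hS i3
  linarith

/-- Each factor `B²` pays for one differentiation; by commutation the intermediate terms are
`(B²)^(s-i) W^i f`. -/
lemma iterRel_pow (hE : AveragingEstimates p q A B W D K) (s : ℕ) (f : E) :
    IterRel D s (((B * B) ^ s) f) ((W ^ s) f) := by
  have hc : Commute W ((B * B) : Module.End 𝕜 E) := by
    have : Commute W B := hE.commute.symm
    exact this.mul_right this
  induction s generalizing f with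
  | zero => rfl
  | succ s ih =>
    refine ⟨W (((B * B) ^ s) f), ?_, ?_⟩
    · rw [pow_succ']
      exact hE.rel_sq _
    · rw [← Module.End.mul_apply, (hc.pow_right s).eq, pow_succ]
      exact ih (W f)

/-- Each `W` is exchanged for a factor `1 - B`, which commutes past the remaining ones. -/
lemma derivative_pow_le (hE : AveragingEstimates p q A B W D K) (s : ℕ) (f : E) :
    p ((W ^ s) f) ≤ K ^ s * p (((1 - B) ^ s) f) := by
  have hc : Commute (1 - B) W := (Commute.one_left W).sub_left hE.commute
  induction s generalizing f with
  | zero => simp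
  | succ s ih =>
    rw [pow_succ' W, Module.End.mul_apply, pow_succ' K, mul_assoc]
    refine (hE.derivative_le _).trans (mul_le_mul_of_nonneg_left ?_ hE.nonneg)
    rw [← Module.End.mul_apply, (hc.pow_right s).eq, pow_succ (1 - B)]
    exact ih ((1 - B) f)

lemma exists_approximation (hE : AveragingEstimates p q A B W D K) (s : ℕ) (f : E) :
    ∃ φ : E, p (f - ((B * B) ^ s) φ) ≤
        (∑ i ∈ Finset.range (2 * s), K ^ i) ^ s * p (((1 - B) ^ s) f) ∧
      p ((W ^ s) φ) ≤ K ^ s * (∑ i ∈ Finset.range s, (1 + K ^ (2 * s)) ^ i) *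
        p (((1 - B) ^ s) f) := by
  have hK := hE.nonneg
  have hBB : (B * B) ^ s = B ^ (2 * s) := by rw [← pow_two, pow_mul]
  set T : Module.End 𝕜 E := 1 - B ^ (2 * s) with hT
  set Q : Module.End 𝕜 E := ∑ i ∈ Finset.range s, T ^ i with hQ
  have hB1 : Commute (1 - B) B := (Commute.one_left B).sub_left (Commute.refl B)
  have hTf : ∀ f, p (T f) ≤ (1 + K ^ (2 * s)) * p f := fun f => by
    have h1 := map_sub_le_add p f ((B ^ (2 * s)) f)
    have h2 := seminorm_pow_le hK hE.snd_le (2 * s) f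
    rw [add_mul, one_mul]
    exact h1.trans (by linarith)
  -- With `φ = f` alone, `f - B^(2s) f` would contain only one factor `1 - B`. The geometric sum `Q`
  -- turns the error into `T^s f`, and each `T` is divisible by `1 - B`.
  refine ⟨Q f, ?_, ?_⟩
  · have h1 : f - ((B * B) ^ s) (Q f) = (T ^ s) f := by
      have : (B * B) ^ s * Q = 1 - T ^ s := by
        rw [hBB, hQ, ← mul_neg_geom_sum, hT, sub_sub_cancel]
      rw [← Module.End.mul_apply, this]
      exact sub_sub_cancel _ _
    have h2 : T ^ s = (∑ i ∈ Finset.range (2 * s), B ^ i) ^ s * (1 - B) ^ s := by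
      have hc : Commute (∑ i ∈ Finset.range (2 * s), B ^ i) (1 - B) :=
        Commute.sum_left _ _ _ fun i _ => (hB1.pow_right i).symm
      rw [← hc.mul_pow, geom_sum_mul_neg]
    rw [h1, h2]
    exact seminorm_pow_le (Finset.sum_nonneg fun i _ => by positivity)
      (seminorm_geom_sum_le hK hE.snd_le (2 * s)) s _
  · have hc : Commute ((1 - B) ^ s) Q := by
      refine Commute.pow_left (Commute.sum_right _ _ _ fun i _ => Commute.pow_right ?_ i) s
      exact (Commute.one_right _).sub_right (hB1.pow_right _)
    refine (hE.derivative_pow_le s (Q f)).trans ?_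
    rw [← Module.End.mul_apply, hc.eq, mul_assoc]
    exact mul_le_mul_of_nonneg_left
      (seminorm_geom_sum_le (by positivity) hTf s _) (by positivity)

/-- The constant of `AveragingEstimates.exists_approximation_le`. -/
noncomputable def approximationConstant (K : ℝ) (r s : ℕ) : ℝ :=
  1 + (1 + ∑ i ∈ Finset.range r, K * K ^ i) * (∑ i ∈ Finset.range (2 * s), K ^ i) ^ s +
    (1 + K ^ r) * (K ^ s * ∑ i ∈ Finset.range s, (1 + K ^ (2 * s)) ^ i)

lemma approximationConstant_pos (hK : 0 ≤ K) (r s : ℕ) : 0 < approximationConstant K r s := by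
  unfold approximationConstant
  positivity

/-- It remains to bound `q (f - g)`. Up to a multiple of `p (f - g)` it is at most `q ((1 - A)^r (f
- g))`, where the part in `f` is given and the part in `g` is bounded by its `s`-th derivative `W^s
φ`. -/
lemma exists_approximation_le (hE : AveragingEstimates p q A B W D K) {r s : ℕ} (hr : r ≠ 0)
    (hs : s ≠ 0) (hsr : s ≤ 2 * r) (f : E) :
    ∃ φ : E, p (f - ((B * B) ^ s) φ) + q (f - ((B * B) ^ s) φ) + p ((W ^ s) φ) ≤
      approximationConstant K r s * (p (((1 - B) ^ s) f) + q (((1 - A) ^ r) f)) := by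
  have hK := hE.nonneg
  obtain ⟨φ, h1, h2⟩ := hE.exists_approximation s f
  refine ⟨φ, ?_⟩
  set g := ((B * B) ^ s) φ
  have h3 : q (f - g) ≤ q (((1 - A) ^ r) f) + q (((1 - A) ^ r) g) +
      (∑ i ∈ Finset.range r, K * K ^ i) * p (f - g) := by
    have h4 := map_add_le_add q ((f - g) - ((1 - A) ^ r) (f - g)) (((1 - A) ^ r) (f - g))
    rw [sub_add_cancel] at h4
    have h5 := map_sub_le_add q (((1 - A) ^ r) f) (((1 - A) ^ r) g)
    rw [← map_sub ((1 - A) ^ r)] at h5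
    linarith [hE.sub_pow_le r (f - g)]
  have h4 := hE.one_sub_fst_pow_le hr hs hsr (hE.iterRel_pow s φ)
  have hS : 0 ≤ ∑ i ∈ Finset.range r, K * K ^ i := Finset.sum_nonneg fun i _ => by positivity
  have hc₁ : 0 ≤ (∑ i ∈ Finset.range (2 * s), K ^ i) ^ s := by positivity
  have hc₂ : 0 ≤ K ^ s * ∑ i ∈ Finset.range s, (1 + K ^ (2 * s)) ^ i := by positivity
  have hKr : 0 ≤ K ^ r := by positivity
  have hd := apply_nonneg p (((1 - B) ^ s) f)
  have he := apply_nonneg q (((1 - A) ^ r) f)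
  unfold approximationConstant
  generalize ∑ i ∈ Finset.range r, K * K ^ i = S at *
  generalize (∑ i ∈ Finset.range (2 * s), K ^ i) ^ s = c₁ at *
  generalize K ^ s * ∑ i ∈ Finset.range s, (1 + K ^ (2 * s)) ^ i = c₂ at *
  have j1 := mul_le_mul_of_nonneg_left h1 hS
  have j2 := mul_le_mul_of_nonneg_left h2 hKr
  have j3 : 0 ≤ ((1 + S) * c₁ + (1 + K ^ r) * c₂) * q (((1 - A) ^ r) f) := by positivity
  linarith

end AveragingEstimates

end SemiDiscrete

/-! ### Absolutely continuous functions and the spaces `X^s` -/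

lemma LipschitzWith.comp_absolutelyContinuousOnInterval {X Y : Type*} [PseudoMetricSpace X]
    [PseudoMetricSpace Y] {φ : X → Y} (hφ : LipschitzWith 1 φ) {f : ℝ → X} {a b : ℝ}
    (hf : AbsolutelyContinuousOnInterval f a b) :
    AbsolutelyContinuousOnInterval (φ ∘ f) a b := by
  rw [absolutelyContinuousOnInterval_iff] at hf ⊢
  intro ε hε
  obtain ⟨δ, hδ, h⟩ := hf ε hε
  refine ⟨δ, hδ, fun I hI hI' => (Finset.sum_le_sum fun i _ => ?_).trans_lt (h I hI hI')⟩
  simpa using hφ.dist_le_mul (f (I.2 i).1) (f (I.2 i).2)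

/-- The fundamental theorem of calculus for absolutely continuous functions with real or complex
values. -/
lemma AbsolutelyContinuousOnInterval.integral_deriv_eq_sub_of_rclike {𝕜 : Type*} [RCLike 𝕜]
    {f : ℝ → 𝕜} {a b : ℝ} (hf : AbsolutelyContinuousOnInterval f a b)
    (hi : IntervalIntegrable (deriv f) volume a b) :
    ∫ x in a..b, deriv f x = f b - f a := by
  have hdiff : ∀ᵐ x : ℝ, x ∈ Set.uIcc a b → DifferentiableAt ℝ f x :=
    hf.boundedVariationOn.ae_differentiableAt_of_mem_uIcc
  -- A 1-Lipschitz real functional reduces the claim to real-valued functions; the real and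
  -- imaginary parts then determine the integral.
  have key : ∀ L : 𝕜 →L[ℝ] ℝ, LipschitzWith 1 L →
      L (∫ x in a..b, deriv f x) = L (f b - f a) := fun L hL => by
    rw [← L.intervalIntegral_comp_comm hi, map_sub,
      show L (f b) - L (f a) = (L ∘ f) b - (L ∘ f) a from rfl,
      ← (hL.comp_absolutelyContinuousOnInterval hf).integral_deriv_eq_sub]
    refine intervalIntegral.integral_congr_ae ?_
    filter_upwards [hdiff] with x hx hxab
    exact ((L.hasFDerivAt.comp_hasDerivAt x
      (hx (Set.uIoc_subset_uIcc hxab)).hasDerivAt).deriv).symm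
  refine RCLike.ext ?_ ?_
  · exact key RCLike.reCLM (AddMonoidHomClass.lipschitz_of_bound_nnnorm _ 1 fun x => by
      rw [one_mul]
      exact RCLike.norm_re_le_norm x)
  · exact key RCLike.imCLM (AddMonoidHomClass.lipschitz_of_bound_nnnorm _ 1 fun x => by
      rw [one_mul]
      exact RCLike.norm_im_le_norm x)

namespace SemiDiscrete

variable {𝕜 : Type*} [RCLike 𝕜]

namespace BanachFunctionLattice

variable {X : BanachFunctionLattice 𝕜} {h : ℝ}

lemma periodic_iteratedDeriv {g : ℝ → 𝕜} {c : ℝ} (hg : Function.Periodic g c) (i : ℕ) :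
    Function.Periodic (iteratedDeriv i g) c := fun x => by
  have := congrFun (iteratedDeriv_comp_add_const i g c) x
  rw [← this]
  simp only [hg _]

lemma iteratedDeriv_mem {s : ℕ} (hs : s ≠ 0) {g : ℝ → 𝕜} (hg : g ∈ X.sobolev s) {i : ℕ}
    (hi : i ≤ s) : iteratedDeriv i g ∈ X.carrier := by
  obtain ⟨hp, hc, -, hm⟩ := hg
  rcases hi.eq_or_lt with rfl | hi
  · exact hm
  · exact mem_of_continuous (periodic_iteratedDeriv hp i)
      (hc.continuous_iteratedDeriv i (by exact_mod_cast Nat.le_sub_one_of_lt hi))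

lemma mem_of_mem_sobolev {s : ℕ} (hs : s ≠ 0) {g : ℝ → 𝕜} (hg : g ∈ X.sobolev s) :
    g ∈ X.carrier := by
  simpa using iteratedDeriv_mem hs hg (Nat.zero_le s)

/-- Only `i = s - 1` needs the assumed absolute continuity; below that, the derivative is
continuously differentiable. -/
lemma integral_iteratedDeriv_succ {s : ℕ} {g : ℝ → 𝕜} (hg : g ∈ X.sobolev s) {i : ℕ}
    (hi : i < s) (a b : ℝ) :
    ∫ t in a..b, iteratedDeriv (i + 1) g t = iteratedDeriv i g b - iteratedDeriv i g a := by
  have hmem := iteratedDeriv_mem (by lia) hg (i := i + 1) hi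
  rw [iteratedDeriv_succ] at hmem ⊢
  refine AbsolutelyContinuousOnInterval.integral_deriv_eq_sub_of_rclike ?_
    (intervalIntegrable hmem a b)
  rcases (Nat.le_sub_one_of_lt hi).eq_or_lt with rfl | hi
  · exact hg.2.2.1 a b
  · refine ContDiffOn.absolutelyContinuousOnInterval (ContDiff.contDiffOn ?_)
    exact (contDiff_nat_succ_iff_contDiff_one_iteratedDeriv.1
      (hg.2.1.of_le (by exact_mod_cast Nat.succ_le_of_lt hi))).2

/-- The chain of weak derivatives is `h^i g^(i)`. -/
lemma iterRel_of_mem_sobolev {s : ℕ} (hs : s ≠ 0) {g : X.Space}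
    (hg : (g : ℝ → 𝕜) ∈ X.sobolev s) {d : X.Space}
    (hd : (d : ℝ → 𝕜) = ((h ^ s : ℝ) : 𝕜) • iteratedDeriv s g) :
    IterRel (IsDeriv h) s g d := by
  suffices H : ∀ j i : ℕ, i + j = s → ∀ w : X.Space,
      (w : ℝ → 𝕜) = ((h ^ i : ℝ) : 𝕜) • iteratedDeriv i g → IterRel (IsDeriv h) j w d from
    H s 0 (zero_add s) g (by simp)
  intro j
  induction j with
  | zero =>
    rintro i rfl w hw
    exact Space.ext fun x => by rw [hw, hd, add_zero]
  | succ j ih =>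
    intro i hij w hw
    obtain ⟨v, hv⟩ := Space.exists_coe_eq (X.carrier.smul_mem ((h ^ (i + 1) : ℝ) : 𝕜)
      (iteratedDeriv_mem hs hg (i := i + 1) (by lia)))
    refine ⟨v, fun a b => ?_, ih (i + 1) (by lia) v hv⟩
    simp only [hv, hw, Pi.smul_apply, intervalIntegral.integral_smul,
      integral_iteratedDeriv_succ hg (show i < s by lia)]
    rw [← smul_sub, RCLike.real_smul_eq_coe_smul (K := 𝕜), smul_smul, ← RCLike.ofReal_mul,
      pow_succ']

lemma contDiff_averageEnd_sq_pow (hh : 0 < h) (j : ℕ) (φ : X.Space)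
    -- For `j = 0` nothing is averaged, so continuity is assumed. In the induction it is applied to
    -- `W φ`, which is always continuous.
    (hφ : j = 0 → Continuous (φ : ℝ → 𝕜)) :
    ContDiff ℝ j (((X.averageEnd 0 h * X.averageEnd 0 h) ^ j) φ : ℝ → 𝕜) ∧
      iteratedDeriv j (((X.averageEnd 0 h * X.averageEnd 0 h) ^ j) φ : ℝ → 𝕜) =
        (h⁻¹ : ℝ) ^ j • ((X.diffAverageEnd h ^ j) φ : ℝ → 𝕜) := by
  have hc : Commute (X.diffAverageEnd h)
      (X.averageEnd 0 h * X.averageEnd 0 h : Module.End 𝕜 X.Space) := by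
    have : Commute (X.diffAverageEnd h) (X.averageEnd 0 h) := commute_diffAverageEnd.symm
    exact this.mul_right this
  induction j generalizing φ with
  | zero => exact ⟨contDiff_zero.2 (hφ rfl), by simp⟩
  | succ j ih =>
    obtain ⟨h1, h2⟩ := ih (X.diffAverageEnd h φ) fun _ => continuous_diffAverageEnd φ
    have hd : ∀ x, HasDerivAt
        (((X.averageEnd 0 h * X.averageEnd 0 h) ^ (j + 1)) φ : ℝ → 𝕜)
        (((h⁻¹ : ℝ) • (((X.averageEnd 0 h * X.averageEnd 0 h) ^ j) (X.diffAverageEnd h φ) :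
          ℝ → 𝕜)) x) x := fun x => by
      rw [← Module.End.mul_apply, ← (hc.pow_right j).eq, pow_succ']
      exact (isDeriv_diffAverageEnd hh _).hasDerivAt hh.ne' (continuous_diffAverageEnd _) x
    have hderiv := deriv_eq hd
    refine ⟨?_, ?_⟩
    · push_cast
      rw [contDiff_succ_iff_deriv, hderiv]
      exact ⟨fun x => (hd x).differentiableAt, by simp, h1.const_smul (h⁻¹)⟩
    · rw [iteratedDeriv_succ', hderiv, pow_succ' (h⁻¹), pow_succ, mul_smul]
      rw [Module.End.mul_apply, ← h2]
      ext x
      exact iteratedDeriv_const_smul_field _ _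

lemma averageEnd_sq_pow_mem_sobolev (hh : 0 < h) {s : ℕ} (hs : s ≠ 0) (φ : X.Space) :
    (((X.averageEnd 0 h * X.averageEnd 0 h) ^ s) φ : ℝ → 𝕜) ∈ X.sobolev s := by
  obtain ⟨h1, h2⟩ := contDiff_averageEnd_sq_pow hh s φ fun h => absurd h hs
  refine ⟨X.periodic _ (Subtype.prop _), h1.of_le (by exact_mod_cast Nat.sub_le s 1),
    fun a b => ?_, ?_⟩
  · obtain ⟨t, rfl⟩ := Nat.exists_eq_succ_of_ne_zero hs
    exact (contDiff_nat_succ_iff_contDiff_one_iteratedDeriv.1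
      h1).2.contDiffOn.absolutelyContinuousOnInterval
  · rw [h2]
    have := X.carrier.smul_mem (((h⁻¹ : ℝ) ^ s : ℝ) : 𝕜) ((X.diffAverageEnd h ^ s) φ).2
    convert! this using 1
    ext x
    simp [RCLike.real_smul_eq_coe_mul]

end BanachFunctionLattice

/-! ### Uniform constants and comparison with the `K`-functional -/

namespace BanachFunctionLattice

variable {X : BanachFunctionLattice 𝕜} {γ γ' C : ℝ}

lemma SteklovBound.seminorm_le (hC : X.SteklovBound C) {h : ℝ} (hh : 0 < h) {F f : X.Space}
    (hF : ∀ x, ‖(F : ℝ → 𝕜) x‖ ≤ h⁻¹ * ∫ t in (x - h)..(x + h), ‖(f : ℝ → 𝕜) t‖) :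
    X.seminorm F ≤ 2 * C * X.seminorm f := by
  have := (hC.of_norm_le_integral f.2 (X.periodic F F.2) (X.measurable F F.2)
    (by positivity : 0 ≤ h⁻¹) hh hF).2
  rwa [mul_assoc 2, inv_mul_cancel₀ hh.ne', mul_one] at this

lemma SteklovBound.discreteSeminorm_le' (hC : X.SteklovBound C) (N : Nodes γ γ') (hγ : 0 < γ)
    (hγ' : 0 < γ') {n : ℕ} (hn : 1 ≤ n) {F f : X.Space}
    (hF : ∀ x, ‖(F : ℝ → 𝕜) x‖ ≤
      (γ / n)⁻¹ * ∫ t in (x - γ / n)..(x + γ / n), ‖(f : ℝ → 𝕜) t‖) :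
    X.discreteSeminorm N n F ≤ 2 * (1 + γ' / γ) * C * X.seminorm f := by
  have hn0 : (0 : ℝ) < n := by exact_mod_cast hn
  have hh : 0 < γ / n := by positivity
  refine (hC.discreteSeminorm_le N hγ hγ' hn (by positivity) hh hF).trans_eq ?_
  field_simp

lemma SteklovBound.exists_averagingEstimates (hC : X.SteklovBound C) (N : Nodes γ γ')
    (hγ : 0 < γ) (hγ' : 0 < γ') : ∃ K : ℝ, 0 ≤ K ∧ ∀ n : ℕ, 1 ≤ n →
      AveragingEstimates X.seminorm (X.discreteSeminorm N n)
        (X.averageEnd (-(γ / n / 2)) (γ / n)) (X.averageEnd 0 (γ / n))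
        (X.diffAverageEnd (γ / n)) (IsDeriv (γ / n)) K := by
  obtain ⟨K₀, hK₀, hW⟩ := hC.exists_diffAverageEnd_le
  have hC0 := hC.1
  have hρ : 0 ≤ 2 * (1 + γ' / γ) * C := by positivity
  -- The three summands cover the bound for `W`, the bounds in the norm of `X`, and the bounds at
  -- the nodes; none depends on `n`.
  set K := K₀ + (1 + 4 * C) + 2 * (1 + γ' / γ) * C with hK
  have hK0 : 0 ≤ K := by positivity
  have h1 : K₀ ≤ K := by linarith
  have h2 : 1 + 4 * C ≤ K := by linarith
  have h3 : 2 * (1 + γ' / γ) * C ≤ K := by linarith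
  refine ⟨K, hK0, fun n hn => ?_⟩
  have hn0 : (0 : ℝ) < n := by exact_mod_cast hn
  have hh : 0 < γ / n := by positivity
  have mono : ∀ {a b : ℝ} (f : X.Space), a ≤ b → b ≤ K → a * X.seminorm f ≤ K * X.seminorm f :=
    fun f hab hb => mul_le_mul_of_nonneg_right (hab.trans hb) (apply_nonneg _ _)
  have hone : ∀ {a : ℝ}, -(2 * (γ / n)) ≤ a → a ≤ γ / n → ∀ f : X.Space,
      X.seminorm ((1 - X.averageEnd a (γ / n)) f) ≤ K * X.seminorm f := fun ha ha' f => by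
    refine le_trans ?_ (mono f le_rfl h2)
    rw [add_mul, one_mul]
    exact (map_sub_le_add X.seminorm f _).trans
      (add_le_add le_rfl (hC.averageEnd_le hh ha ha' f))
  exact
    { nonneg := hK0
      commute := commute_diffAverageEnd
      rel_sq := isDeriv_diffAverageEnd hh
      rel_one_sub_fst := fun g w hgw => hgw.one_sub_averageEnd _ _
      rel_one_sub_snd := fun g w hgw => hgw.one_sub_averageEnd _ _
      snd_le := fun f => (hC.averageEnd_le hh (by linarith) hh.le f).trans
        (mono f (by linarith) h2)
      one_sub_fst_le := hone (by linarith) (by linarith)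
      one_sub_snd_le := hone (by linarith) hh.le
      fst_le' := fun f => (hC.discreteSeminorm_le' N hγ hγ' hn
        (norm_average_le f.2 hh (by linarith) (by linarith))).trans (mono f le_rfl h3)
      derivative_le := fun f => (hW _ hh f).trans (mono _ le_rfl h1)
      one_sub_snd_le_of_rel := fun g w hgw => (hC.seminorm_le hh
        (hgw.norm_one_sub_averageEnd_le hh (by linarith) le_rfl)).trans
          (mono w (by linarith) h2)
      one_sub_fst_le_of_rel := fun g w hgw => (hC.seminorm_le hh
        (hgw.norm_one_sub_averageEnd_le hh (by linarith) (by linarith))).trans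
          (mono w (by linarith) h2)
      one_sub_fst_le_of_rel_of_rel := fun g w v hgw hwv => (hC.seminorm_le hh
        (hgw.norm_one_sub_averageEnd_le' hh hwv)).trans (mono v (by linarith) h2)
      one_sub_fst_le_of_rel' := fun g w hgw => (hC.discreteSeminorm_le' N hγ hγ' hn
        (hgw.norm_one_sub_averageEnd_le hh (by linarith) (by linarith))).trans
          (mono w le_rfl h3)
      one_sub_fst_le_of_rel_of_rel' := fun g w v hgw hwv => (hC.discreteSeminorm_le' N hγ hγ' hn
        (hgw.norm_one_sub_averageEnd_le' hh hwv)).trans (mono v le_rfl h3) }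

lemma norm_real_smul {f : ℝ → 𝕜} (hf : f ∈ X.carrier) {c : ℝ} (hc : 0 ≤ c) :
    X.norm (c • f) = c * X.norm f := by
  have : c • f = (c : 𝕜) • f := funext fun x => RCLike.real_smul_eq_coe_smul (K := 𝕜) c (f x)
  rw [this, X.norm_smul _ _ hf, RCLike.norm_ofReal, abs_of_nonneg hc]

lemma kFunctional_summand_nonneg (N : Nodes γ γ') (n : ℕ) {s : ℕ} (hs : s ≠ 0) (f : X.Space)
    (g : X.sobolev s) : 0 ≤ X.norm (f - g.1) + X.discreteNorm N n (f - g.1) +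
      (1 / n : ℝ) ^ s * X.norm (iteratedDeriv s g.1) := by
  have h1 := norm_nonneg (X.carrier.sub_mem f.2 (mem_of_mem_sobolev hs g.2))
  have h2 : 0 ≤ X.discreteNorm N n (f - g.1) := norm_nonneg (step_mem N n _)
  have h3 := norm_nonneg g.2.2.2.2
  positivity

lemma sobolev_nonempty (X : BanachFunctionLattice 𝕜) {s : ℕ} (hs : s ≠ 0) :
    Nonempty (X.sobolev s) :=
  ⟨_, averageEnd_sq_pow_mem_sobolev one_pos hs (0 : X.Space)⟩

/-- The abstract estimate weighs the derivative by `(γ/n)^s`, the `K`-functional by `(1/n)^s`; the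
factor `1 + γ^s` dominates both `1` and `γ^s`. -/
lemma le_kFunctional (N : Nodes γ γ') {n : ℕ} (hγ : 0 < γ) (hn : 1 ≤ n) {s : ℕ} (hs : s ≠ 0)
    (f : X.Space) {M L : ℝ} (hL : 0 < L)
    (h : ∀ g d : X.Space, IterRel (IsDeriv (γ / n)) s g d →
      M ≤ L * (X.seminorm (f - g) + X.discreteSeminorm N n (f - g) + X.seminorm d)) :
    (L * (1 + γ ^ s))⁻¹ * M ≤ X.kFunctional N n s f (1 / n) := by
  have hn0 : (0 : ℝ) < n := by exact_mod_cast hn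
  have := sobolev_nonempty X hs
  refine le_ciInf fun g => ?_
  obtain ⟨G, hG⟩ := Space.exists_coe_eq (mem_of_mem_sobolev hs g.2)
  have hmem := X.carrier.smul_mem (((γ / n) ^ s : ℝ) : 𝕜) g.2.2.2.2
  obtain ⟨d, hd⟩ := Space.exists_coe_eq hmem
  have hGd := h G d (iterRel_of_mem_sobolev hs (hG ▸ g.2) (by rw [hd, hG]))
  rw [seminorm_apply, seminorm_apply, discreteSeminorm_apply, Space.coe_sub, hG, hd,
    X.norm_smul _ _ g.2.2.2.2, RCLike.norm_ofReal, abs_of_pos (by positivity)] at hGd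
  rw [inv_mul_le_iff₀ (by positivity), mul_assoc]
  refine hGd.trans (mul_le_mul_of_nonneg_left ?_ hL.le)
  have h1 := norm_nonneg (X.carrier.sub_mem f.2 (mem_of_mem_sobolev hs g.2))
  have h2 : 0 ≤ X.discreteNorm N n (f - g.1) := norm_nonneg (step_mem N n _)
  have h3 : 0 ≤ (1 / n : ℝ) ^ s * X.norm (iteratedDeriv s g.1) :=
    mul_nonneg (by positivity) (norm_nonneg g.2.2.2.2)
  have h4 : (γ / n) ^ s = γ ^ s * (1 / n : ℝ) ^ s := by rw [← mul_pow, mul_one_div]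
  have h5 : 0 ≤ γ ^ s * (X.norm (f - g.1) + X.discreteNorm N n (f - g.1)) := by positivity
  rw [h4, mul_assoc]
  linarith

/-- The smoothed function is an admissible competitor in the infimum, and `1 + (γ^s)⁻¹` accounts for
the change of step from `γ/n` to `1/n`. -/
lemma kFunctional_le (N : Nodes γ γ') {n : ℕ} (hγ : 0 < γ) (hn : 1 ≤ n) {s : ℕ} (hs : s ≠ 0)
    (f φ : X.Space) :
    X.kFunctional N n s f (1 / n) ≤ (1 + (γ ^ s)⁻¹) *
      (X.seminorm (f - ((X.averageEnd 0 (γ / n) * X.averageEnd 0 (γ / n)) ^ s) φ) +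
        X.discreteSeminorm N n (f - ((X.averageEnd 0 (γ / n) * X.averageEnd 0 (γ / n)) ^ s) φ) +
        X.seminorm ((X.diffAverageEnd (γ / n) ^ s) φ)) := by
  have hn0 : (0 : ℝ) < n := by exact_mod_cast hn
  have hh : 0 < γ / n := by positivity
  have hg := averageEnd_sq_pow_mem_sobolev hh hs φ
  have hd := (contDiff_averageEnd_sq_pow hh s φ fun h => absurd h hs).2
  set g := ((X.averageEnd 0 (γ / n) * X.averageEnd 0 (γ / n)) ^ s) φ
  set w := (X.diffAverageEnd (γ / n) ^ s) φ
  refine (ciInf_le ⟨0, Set.forall_mem_range.2 fun g => kFunctional_summand_nonneg N n hs f g⟩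
    ⟨(g : ℝ → 𝕜), hg⟩).trans ?_
  have h1 : X.norm (iteratedDeriv s (g : ℝ → 𝕜)) = (γ / n)⁻¹ ^ s * X.seminorm w := by
    rw [hd, norm_real_smul w.2 (by positivity), seminorm_apply]
  have h2 : (1 / n : ℝ) ^ s * ((γ / n)⁻¹ ^ s * X.seminorm w) = (γ ^ s)⁻¹ * X.seminorm w := by
    rw [← mul_assoc, ← mul_pow, show (1 / n : ℝ) * (γ / n)⁻¹ = γ⁻¹ by field_simp, inv_pow]
  have h3 : X.norm ((f : ℝ → 𝕜) - g) = X.seminorm (f - g) := rfl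
  have h4 : X.discreteNorm N n ((f : ℝ → 𝕜) - g) = X.discreteSeminorm N n (f - g) := rfl
  simp only [h1, h2, h3, h4]
  have i1 := apply_nonneg X.seminorm (f - g)
  have i2 := apply_nonneg (X.discreteSeminorm N n) (f - g)
  have i3 := apply_nonneg X.seminorm w
  have i4 : 0 ≤ (γ ^ s)⁻¹ * (X.seminorm (f - g) + X.discreteSeminorm N n (f - g)) := by positivity
  linarith

end BanachFunctionLattice

end SemiDiscrete

theorem theorem3p4 {𝕜 : Type*} [RCLike 𝕜] (X : SemiDiscrete.BanachFunctionLattice 𝕜)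
    (hX : X.SteklovBounded) (r s : ℕ) (hr : 1 ≤ r) (hs : 1 ≤ s) (hrs : s ≤ 2 * r)
    (γ γ' : ℝ) (hγ : 0 < γ) (hγ' : 0 < γ') (N : SemiDiscrete.Nodes γ γ') :
    ∃ c C : ℝ, 0 < c ∧ 0 < C ∧ ∀ n : ℕ, 1 ≤ n → ∀ f ∈ X.carrier,
      c * (X.norm (SemiDiscrete.powOneSub (SemiDiscrete.dotSteklov (γ / n)) s f) +
          X.discreteNorm N n (SemiDiscrete.powOneSub (SemiDiscrete.steklov (γ / n)) r f)) ≤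
        X.kFunctional N n s f (1 / n) ∧
      X.kFunctional N n s f (1 / n) ≤
        C * (X.norm (SemiDiscrete.powOneSub (SemiDiscrete.dotSteklov (γ / n)) s f) +
          X.discreteNorm N n (SemiDiscrete.powOneSub (SemiDiscrete.steklov (γ / n)) r f)) := by
  obtain ⟨C, hC1, hC⟩ := hX.exists_bound
  have hb : X.SteklovBound C :=
    ⟨zero_le_one.trans hC1, fun h hh f hf => ⟨hX.1 f hf h hh, hC h hh f hf⟩⟩
  obtain ⟨K, hK, hE⟩ := hb.exists_averagingEstimates N hγ hγ'
  have hr0 : r ≠ 0 := by lia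
  have hs0 : s ≠ 0 := by lia
  have hL : 0 < 1 + K ^ s + K ^ r + ∑ i ∈ Finset.range r, K * K ^ i := by positivity
  have hA := SemiDiscrete.AveragingEstimates.approximationConstant_pos hK r s
  refine ⟨_, _, inv_pos.2 (mul_pos hL (by positivity : 0 < 1 + γ ^ s)),
    mul_pos (by positivity : 0 < 1 + (γ ^ s)⁻¹) hA, fun n hn f hf => ?_⟩
  obtain ⟨f, rfl⟩ := SemiDiscrete.BanachFunctionLattice.Space.exists_coe_eq hf
  rw [SemiDiscrete.steklov_eq_average, SemiDiscrete.dotSteklov_eq_average,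
    SemiDiscrete.BanachFunctionLattice.powOneSub_average,
    SemiDiscrete.BanachFunctionLattice.powOneSub_average,
    ← SemiDiscrete.BanachFunctionLattice.seminorm_apply,
    ← SemiDiscrete.BanachFunctionLattice.discreteSeminorm_apply]
  constructor
  · exact SemiDiscrete.BanachFunctionLattice.le_kFunctional N hγ hn hs0 f hL fun g d hgd =>
      (hE n hn).add_le hr0 hs0 hrs hgd
  · obtain ⟨φ, hφ⟩ := (hE n hn).exists_approximation_le hr0 hs0 hrs f
    rw [mul_assoc]
    exact (SemiDiscrete.BanachFunctionLattice.kFunctional_le N hγ hn hs0 f φ).trans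
      (mul_le_mul_of_nonneg_left hφ (by positivity))
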